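/- Let $X_1$ be a Hilbert C*-module over a C*-algebra $A$ and $X_2$ a Hilbert C*-module over a C*-algebra $B$. A *compact self-adjoint endomorphism* of a Hilbert module $X$ is a bounded operator $b$ on $X$ that lies in the norm-closed linear span of the operators $\theta_{x,y}\colon z\mapsto x\langle y,z\rangle$ ($x,y\in X$) and satisfies $\langle bx,y\rangle=\langle x,by\rangle$ for all $x,y\in X$. For a closed submodule $Y\subseteq X$ write $Y\subset\subset X$ if $Y$ and $X$ are countably generated and some compact self-adjoint endomorphism $b$ of $X$ satisfies $by=y$ for all $y\in Y$; such a $b$ is called a witness of $Y\subset\subset X$. Let $A\otimes B$ be the completion of the algebraic tensor product $A\odot B$ in the spatial (minimal) C*-norm, or in any other C*-norm (every C*-norm on $A\odot B$ dominates the spatial one). Let $X_1\otimes X_2$ be the external tensor product, that is, the Hilbert $A\otimes B$-module obtained by completing $X_1\odot X_2$ in the norm induced by the $A\otimes B$-valued inner product $\langle x_1\otimes x_2,x_1'\otimes x_2'\rangle=\langle x_1,x_1'\rangle\otimes\langle x_2,x_2'\rangle$. For closed submodules $Y_1\subseteq X_1$ and $Y_2\subseteq X_2$, regard $Y_1\otimes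 Y_2$ as a closed submodule of $X_1\otimes X_2$, namely the closed linear span of the vectors $y_1\otimes y_2$ with $y_i\in Y_i$. **Theorem.** If $Y_1\subset\subset X_1$ and $Y_2\subset\subset X_2$, then $Y_1\otimes Y_2\subset\subset X_1\otimes X_2$. (In particular $Y_1\otimes Y_2$ and $X_1\otimes X_2$ are countably generated.) Moreover, if $b_1$ is a witness of $Y_1\subset\subset X_1$ and $b_2$ is a witness of $Y_2\subset\subset X_2$, then there is a bounded operator $b_1\otimes b_2$ on $X_1\otimes X_2$ with $(b_1\otimes b_2)(x_1\otimes x_2)=b_1x_1\otimes b_2x_2$ for all $x_1\in X_1$ and $x_2\in X_2$, and it is a witness of $Y_1\otimes Y_2\subset\subset X_1\otimes X_2$. -/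

import Mathlib

open scoped TensorProduct

namespace HilbertTensor

set_option linter.unusedSectionVars false

/-! Hilbert C⋆-modules are Mathlib's `CStarModule`s: the inner product is conjugate-linear in the first
variable, and `⟪x, a • y⟫ = a * ⟪x, y⟫`, `⟪a • x, y⟫ = ⟪x, y⟫ * star a`. -/

section Module
variable {A X : Type*} [NonUnitalCStarAlgebra A] [PartialOrder A] [StarOrderedRing A]
  [NormedAddCommGroup X] [NormedSpace ℂ X] [SMul A X] [CStarModule A X]

variable (A) in
/-- Two vectors with the same inner products against everything are equal. -/
theorem ext_inner {x y : X} (h : ∀ z : X, inner A z x = inner A z y) : x = y := by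
  have : inner A (x - y) (x - y) = 0 := by
    rw [CStarModule.inner_sub_right, h (x - y), sub_self]
  exact sub_eq_zero.1 (CStarModule.inner_self.1 this)

variable (A X) in
/-- The action of the coefficient algebra on a Hilbert module, as a bilinear map. -/
def actL : A →ₗ[ℂ] X →ₗ[ℂ] X :=
  LinearMap.mk₂ ℂ (fun a x => a • x)
    (fun a a' x => ext_inner A fun z => by simp [add_mul])
    (fun c a x => ext_inner A fun z => by simp [smul_mul_assoc])
    (fun a x x' => ext_inner A fun z => by simp [mul_add])
    (fun c a x => ext_inner A fun z => by simp [mul_smul_comm])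

@[simp] theorem actL_apply (a : A) (x : X) : actL A X a x = a • x := rfl

variable (A) in
theorem act_norm_le (a : A) (x : X) : ‖a • x‖ ≤ ‖a‖ * ‖x‖ := by
  have h : ‖a • x‖ ^ 2 ≤ (‖a‖ * ‖x‖) ^ 2 := by
    rw [CStarModule.norm_sq_eq A, CStarModule.inner_op_smul_right, CStarModule.inner_op_smul_left]
    calc _ ≤ ‖a‖ * (‖inner A x x‖ * ‖star a‖) :=
          (norm_mul_le _ _).trans (mul_le_mul_of_nonneg_left (norm_mul_le _ _) (norm_nonneg _))
      _ = _ := by rw [norm_star, ← CStarModule.norm_sq_eq A]; ring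
  exact (pow_le_pow_iff_left₀ (norm_nonneg _) (by positivity) (by simp)).1 h

variable (A) in
/-- The elementary ("rank one") operator `θ_{x,y} : z ↦ ⟪y, z⟫ • x` on a Hilbert module. -/
noncomputable def rankOne (x y : X) : X →L[ℂ] X :=
  LinearMap.mkContinuous ((actL A X).flip x ∘ₗ CStarModule.innerₛₗ (A := A) y) (‖y‖ * ‖x‖)
    fun z => by
      calc ‖inner A y z • x‖ ≤ ‖inner A y z‖ * ‖x‖ := act_norm_le A _ _
        _ ≤ ‖y‖ * ‖z‖ * ‖x‖ := by gcongr; exact CStarModule.norm_inner_le X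
        _ = _ := by ring

@[simp] theorem rankOne_apply (x y z : X) : rankOne A x y z = inner A y z • x := rfl

end Module

section Gram
variable {A : Type*} [NonUnitalCStarAlgebra A] [PartialOrder A] [StarOrderedRing A]

/-- The cube of the negative part detects positivity of a self-adjoint element. -/
theorem exists_negPart_test {D : Type*} [NonUnitalCStarAlgebra D] (M : D) (hM : IsSelfAdjoint M) :
    ∃ N S : D, star N = N ∧ N * M * N = -(S * star S) ∧ (S = 0 → ∃ R : D, M = R * star R) := by
  let : PartialOrder D := CStarAlgebra.spectralOrder D
  have : StarOrderedRing D := CStarAlgebra.spectralOrderedRing D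
  have hN : 0 ≤ M⁻ := CFC.negPart_nonneg M
  have hNs : star M⁻ = M⁻ := (IsSelfAdjoint.of_nonneg hN).star_eq
  obtain ⟨r, hr⟩ := CStarAlgebra.nonneg_iff_eq_mul_star_self.1 hN
  refine ⟨M⁻, M⁻ * r, hNs, ?_, fun h => ?_⟩
  · have h1 : M⁻ * M * M⁻ = M⁻ * (M⁺ - M⁻) * M⁻ := by rw [CFC.posPart_sub_negPart M hM]
    rw [h1, mul_sub, CFC.negPart_mul_posPart, zero_sub, neg_mul, star_mul, hNs, mul_assoc M⁻ r,
      ← mul_assoc r, ← hr, ← mul_assoc]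
  · have h2 : M⁻ * M⁻ = 0 := by
      calc M⁻ * M⁻ = M⁻ * (r * star r) := by rw [← hr]
        _ = 0 := by rw [← mul_assoc, h, zero_mul]
    have h3 : M⁻ = 0 := by
      have : star M⁻ * M⁻ = 0 := by rw [hNs, h2]
      exact CStarRing.star_mul_self_eq_zero_iff _ |>.1 this
    have h4 : M = M⁺ := by
      conv_lhs => rw [← CFC.posPart_sub_negPart M hM, h3, sub_zero]
    exact CStarAlgebra.nonneg_iff_eq_mul_star_self.1 (h4 ▸ CFC.posPart_nonneg M)

theorem exists_matrix_factor {n : Type*} [Fintype n] (m : n → n → A)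
    (hm : ∀ i j, star (m j i) = m i j)
    (h : ∀ v : n → A, 0 ≤ ∑ i, ∑ j, v i * m i j * star (v j)) :
    ∃ c : n → n → A, ∀ i j, m i j = ∑ k, c i k * star (c j k) := by
  let M : CStarMatrix n n A := CStarMatrix.ofMatrix m
  have hMe : ∀ i j, M i j = m i j := fun _ _ => rfl
  have hM : IsSelfAdjoint M := by
    ext i j
    rw [CStarMatrix.star_apply]
    exact hm i j
  obtain ⟨N, S, hN, hS, hR⟩ := exists_negPart_test M hM
  have hS0 : S = 0 := by
    have key : ∀ i, ∑ k, S i k * star (S i k) = 0 := by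
      intro i
      have e := congrArg (fun T : CStarMatrix n n A => T i i) hS
      simp only [CStarMatrix.mul_apply, CStarMatrix.neg_apply, CStarMatrix.star_apply,
        Finset.sum_mul] at e
      have hpos : 0 ≤ ∑ k, S i k * star (S i k) :=
        Finset.sum_nonneg fun k _ => mul_star_self_nonneg _
      have hneg : 0 ≤ -∑ k, S i k * star (S i k) := by
        rw [← e, Finset.sum_comm]
        refine (h fun l => N i l).trans_eq ?_
        refine Finset.sum_congr rfl fun k _ => Finset.sum_congr rfl fun l _ => ?_
        rw [hMe]
        congr 1
        conv_rhs => rw [← hN, CStarMatrix.star_apply]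
      exact le_antisymm (by simpa using hneg) hpos
    ext i k
    have h1 := (Finset.sum_eq_zero_iff_of_nonneg fun k _ => mul_star_self_nonneg (S i k)).1
      (key i) k (Finset.mem_univ k)
    exact CStarRing.mul_star_self_eq_zero_iff _ |>.1 h1
  obtain ⟨R, hR⟩ := hR hS0
  refine ⟨fun i k => R i k, fun i j => ?_⟩
  rw [← hMe, hR, CStarMatrix.mul_apply]
  rfl

variable {X : Type*}  [NormedAddCommGroup X] [NormedSpace ℂ X] [SMul A X] [CStarModule A X]

/-- Gram matrices of Hilbert modules factorise. -/
theorem exists_gram {n : Type*} [Fintype n] (x : n → X) :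
    ∃ c : n → n → A, ∀ i j, inner A (x i) (x j) = ∑ k, c j k * star (c i k) := by
  obtain ⟨c, hc⟩ := exists_matrix_factor (fun i j => inner A (x j) (x i)) (by simp) fun v => by
    have : 0 ≤ inner A (∑ j, v j • x j) (∑ j, v j • x j) := CStarModule.inner_self_nonneg
    simpa [Finset.mul_sum, mul_assoc] using this
  exact ⟨c, fun i j => hc j i⟩

end Gram

section Star
variable {A B : Type*} [NonUnitalCStarAlgebra A] [NonUnitalCStarAlgebra B]

theorem tensor_star_mul (s t : A ⊗[ℂ] B) : star (s * t) = star t * star s := by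
  induction s using TensorProduct.induction_on with
  | zero => simp
  | add x y hx hy => simp [add_mul, mul_add, hx, hy]
  | tmul a b =>
    induction t using TensorProduct.induction_on with
    | zero => simp
    | add x y hx hy => simp [add_mul, mul_add, hx, hy]
    | tmul c d => simp
end Star

section Algebraic
variable {A B X Y : Type*}
  [NonUnitalCStarAlgebra A] [PartialOrder A] [StarOrderedRing A]
  [NormedAddCommGroup X] [NormedSpace ℂ X] [SMul A X] [CStarModule A X]
  [NonUnitalCStarAlgebra B] [PartialOrder B] [StarOrderedRing B]
  [NormedAddCommGroup Y] [NormedSpace ℂ Y] [SMul B Y] [CStarModule B Y]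

variable (A B X Y) in
/-- The action of `A ⊙ B` on `X ⊙ Y`: `(a ⊗ b) (x ⊗ y) = a x ⊗ b y`. -/
noncomputable def algAct : A ⊗[ℂ] B →ₗ[ℂ] X ⊗[ℂ] Y →ₗ[ℂ] X ⊗[ℂ] Y :=
  TensorProduct.homTensorHomMap (.id ℂ) X Y X Y ∘ₗ TensorProduct.map (actL A X) (actL B Y)

@[simp] theorem algAct_tmul (a : A) (b : B) (x : X) (y : Y) :
    algAct A B X Y (a ⊗ₜ b) (x ⊗ₜ y) = (a • x) ⊗ₜ (b • y) := by
  simp [algAct]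

variable (A B X Y) in
/-- The `A ⊙ B`-valued inner product on `X ⊙ Y`:
`⟪x₁ ⊗ y₁, x₂ ⊗ y₂⟫ = ⟪x₁, x₂⟫ ⊗ ⟪y₁, y₂⟫`. -/
noncomputable def algInner : X ⊗[ℂ] Y →ₗ⋆[ℂ] X ⊗[ℂ] Y →ₗ[ℂ] A ⊗[ℂ] B :=
  TensorProduct.homTensorHomMap (.id ℂ) X Y A B ∘ₛₗ
    TensorProduct.map (CStarModule.innerₛₗ (A := A) (E := X)) (CStarModule.innerₛₗ (A := B) (E := Y))

@[simp] theorem algInner_tmul (x x' : X) (y y' : Y) :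
    algInner A B X Y (x ⊗ₜ y) (x' ⊗ₜ y') = inner A x x' ⊗ₜ inner B y y' := by
  simp [algInner, CStarModule.innerₛₗ_apply]

theorem star_algInner (s t : X ⊗[ℂ] Y) :
    star (algInner A B X Y s t) = algInner A B X Y t s := by
  induction s using TensorProduct.induction_on with
  | zero => simp
  | add x y hx hy => simp [hx, hy]
  | tmul a b =>
    induction t using TensorProduct.induction_on with
    | zero => simp
    | add x y hx hy => simp [hx, hy]
    | tmul c d => simp

theorem algInner_act_right (c : A ⊗[ℂ] B) (s t : X ⊗[ℂ] Y) :
    algInner A B X Y s (algAct A B X Y c t) = c * algInner A B X Y s t := by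
  induction s using TensorProduct.induction_on with
  | zero => simp
  | add x y hx hy => simp [hx, hy, mul_add]
  | tmul x y =>
    induction t using TensorProduct.induction_on with
    | zero => simp
    | add x y hx hy => simp [hx, hy, mul_add]
    | tmul x' y' =>
      induction c using TensorProduct.induction_on with
      | zero => simp
      | add x y hx hy => simp [hx, hy, add_mul]
      | tmul a b => simp

theorem algInner_act_left (c : A ⊗[ℂ] B) (s t : X ⊗[ℂ] Y) :
    algInner A B X Y (algAct A B X Y c s) t = algInner A B X Y s t * star c := by
  rw [← star_algInner, algInner_act_right, tensor_star_mul, star_algInner]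

/-- The inner product on `X ⊙ Y` is algebraically positive. -/
theorem exists_algInner_self (t : X ⊗[ℂ] Y) :
    ∃ (n : ℕ) (w : Fin n × Fin n → A ⊗[ℂ] B), algInner A B X Y t t = ∑ k, w k * star (w k) := by
  obtain ⟨S, rfl⟩ : ∃ S : Multiset (X × Y), t = (S.map fun i ↦ i.1 ⊗ₜ[ℂ] i.2).sum :=
    TensorProduct.exists_multiset t
  obtain ⟨l, rfl⟩ := Quot.exists_rep S
  obtain ⟨c, hc⟩ := exists_gram (A := A) fun i : Fin l.length => (l.get i).1
  obtain ⟨d, hd⟩ := exists_gram (A := B) fun i : Fin l.length => (l.get i).2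
  have hsum : (Multiset.map (fun i : X × Y ↦ i.1 ⊗ₜ[ℂ] i.2) (Quot.mk _ l)).sum =
      ∑ i : Fin l.length, (l.get i).1 ⊗ₜ[ℂ] (l.get i).2 := by
    change (Multiset.map _ (l : Multiset (X × Y))).sum = _
    rw [Multiset.map_coe, Multiset.sum_coe, ← List.sum_ofFn]
    congr 1
    apply List.ext_get <;> simp
  rw [hsum]
  refine ⟨l.length, fun k => ∑ j, c j k.1 ⊗ₜ[ℂ] d j k.2, ?_⟩
  simp only [map_sum, LinearMap.sum_apply, algInner_tmul, hc, hd, star_sum,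
    TensorProduct.star_tmul, Finset.sum_mul_sum, Algebra.TensorProduct.tmul_mul_tmul,
    TensorProduct.sum_tmul, TensorProduct.tmul_sum, Fintype.sum_prod_type]
  calc ∑ j, ∑ i, ∑ l, ∑ k, (c j k * star (c i k)) ⊗ₜ[ℂ] (d j l * star (d i l))
      = ∑ j, ∑ k, ∑ i, ∑ l, (c j k * star (c i k)) ⊗ₜ[ℂ] (d j l * star (d i l)) := by
        refine Finset.sum_congr rfl fun j _ => ?_
        rw [Finset.sum_comm]
        refine (Finset.sum_congr rfl fun l _ => Finset.sum_comm).trans ?_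
        rw [Finset.sum_comm]
        exact Finset.sum_congr rfl fun k _ => Finset.sum_comm
    _ = _ := by
        rw [Finset.sum_comm]
        refine Finset.sum_congr rfl fun k _ => ?_
        refine (Finset.sum_congr rfl fun j _ => Finset.sum_comm).trans ?_
        rw [Finset.sum_comm]
end Algebraic

section Extend
open UniformSpace Completion
variable {E F G : Type*} [SeminormedAddCommGroup E] [SeminormedAddCommGroup F]
  [SeminormedAddCommGroup G] [NormedSpace ℂ E] [NormedSpace ℂ F] [NormedSpace ℂ G]
  {σ : ℂ →+* ℂ} [RingHomIsometric σ]

theorem norm_completion_le (g : F →L[ℂ] G) : ‖g.completion‖ ≤ ‖g‖ := by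
  refine g.completion.opNorm_le_bound (norm_nonneg _) fun x => ?_
  induction x using Completion.induction_on with
  | hp => exact isClosed_le (by fun_prop) (by fun_prop)
  | ih x => simpa using g.le_opNorm x

theorem completion_ext {g h : Completion F →L[ℂ] Completion G} (H : ∀ x : F, g x = h x) :
    g = h := by
  ext x
  exact Completion.induction_on x (isClosed_eq g.continuous h.continuous) H

/-- Extension of a bounded sesquilinear or bilinear map to the completions. -/
noncomputable def completion₂ (f : E →ₛₗ[σ] F →ₗ[ℂ] G) (hf : ∀ x y, ‖f x y‖ ≤ ‖x‖ * ‖y‖) :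
    Completion E →SL[σ] Completion F →L[ℂ] Completion G :=
  let f₁ : E →ₛₗ[σ] Completion F →L[ℂ] Completion G :=
    { toFun := fun x => ((f x).mkContinuous ‖x‖ (hf x)).completion
      map_add' := fun x y => completion_ext fun z => by simp [Completion.coe_add]
      map_smul' := fun c x => completion_ext fun z => by simp [Completion.coe_smul] }
  ContinuousLinearMap.fromCompletion <| f₁.mkContinuous 1 fun x => by
    rw [one_mul]
    exact (norm_completion_le _).trans (LinearMap.mkContinuous_norm_le _ (norm_nonneg _) _)

@[simp] theorem completion₂_coe (f : E →ₛₗ[σ] F →ₗ[ℂ] G) (hf : ∀ x y, ‖f x y‖ ≤ ‖x‖ * ‖y‖)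
    (x : E) (y : F) : completion₂ f hf x y = (f x y : Completion G) := by
  simp [completion₂]

end Extend

section Alg
variable (A B : Type*) [NonUnitalCStarAlgebra A] [NonUnitalCStarAlgebra B]

/-- A C⋆-seminorm on the algebraic tensor product `A ⊙ B`: it is submultiplicative and satisfies
the C⋆-identity. -/
structure TensorCStarSeminorm extends Seminorm ℂ (A ⊗[ℂ] B) where
  mul_le' : ∀ s t, toFun (s * t) ≤ toFun s * toFun t
  star_mul_self' : ∀ t, toFun (star t * t) = toFun t * toFun t

variable {A B}

/-- The algebraic tensor product `A ⊙ B`, regarded as a space with the seminorm `γ`. -/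
@[nolint unusedArguments]
def PreAlg (_γ : TensorCStarSeminorm A B) : Type _ := A ⊗[ℂ] B

variable (γ : TensorCStarSeminorm A B)

noncomputable instance : NonUnitalRing (PreAlg γ) := inferInstanceAs (NonUnitalRing (A ⊗[ℂ] B))
noncomputable instance : Module ℂ (PreAlg γ) := inferInstanceAs (Module ℂ (A ⊗[ℂ] B))
noncomputable instance : IsScalarTower ℂ (PreAlg γ) (PreAlg γ) :=
  inferInstanceAs (IsScalarTower ℂ (A ⊗[ℂ] B) (A ⊗[ℂ] B))
noncomputable instance : SMulCommClass ℂ (PreAlg γ) (PreAlg γ) :=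
  inferInstanceAs (SMulCommClass ℂ (A ⊗[ℂ] B) (A ⊗[ℂ] B))
noncomputable instance : StarAddMonoid (PreAlg γ) := inferInstanceAs (StarAddMonoid (A ⊗[ℂ] B))
noncomputable instance : StarModule ℂ (PreAlg γ) := inferInstanceAs (StarModule ℂ (A ⊗[ℂ] B))
noncomputable instance : StarRing (PreAlg γ) where
  star_add := star_add
  star_mul := tensor_star_mul (A := A) (B := B)

noncomputable instance : SeminormedAddCommGroup (PreAlg γ) :=
  AddGroupSeminorm.toSeminormedAddCommGroup (E := PreAlg γ) γ.toSeminorm.toAddGroupSeminorm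

noncomputable instance : NormedSpace ℂ (PreAlg γ) where
  norm_smul_le c t := (γ.smul' c t).le

theorem PreAlg.norm_mul_le (s t : PreAlg γ) : ‖s * t‖ ≤ ‖s‖ * ‖t‖ := γ.mul_le' s t
theorem PreAlg.norm_star_mul_self (t : PreAlg γ) : ‖star t * t‖ = ‖t‖ * ‖t‖ := γ.star_mul_self' t

theorem PreAlg.norm_star_le (t : PreAlg γ) : ‖t‖ ≤ ‖star t‖ := by
  by_contra! h
  have h1 := PreAlg.norm_star_mul_self γ t
  have h2 := PreAlg.norm_mul_le γ (star t) t
  have h3 : 0 < ‖t‖ := (norm_nonneg _).trans_lt h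
  nlinarith

theorem PreAlg.norm_star (t : PreAlg γ) : ‖star t‖ = ‖t‖ :=
  le_antisymm (by simpa using PreAlg.norm_star_le γ (star t)) (PreAlg.norm_star_le γ t)

/-- The C⋆-algebra `A ⊗_γ B`: the (Hausdorff) completion of `A ⊙ B` for the seminorm `γ`. -/
def CStarTensor (γ : TensorCStarSeminorm A B) : Type _ := UniformSpace.Completion (PreAlg γ)

noncomputable instance : NormedAddCommGroup (CStarTensor γ) :=
  inferInstanceAs (NormedAddCommGroup (UniformSpace.Completion (PreAlg γ)))
noncomputable instance : NormedSpace ℂ (CStarTensor γ) :=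
  inferInstanceAs (NormedSpace ℂ (UniformSpace.Completion (PreAlg γ)))
instance : CompleteSpace (CStarTensor γ) :=
  inferInstanceAs (CompleteSpace (UniformSpace.Completion (PreAlg γ)))

/-- The canonical map `A ⊙ B → A ⊗_γ B`. -/
noncomputable def CStarTensor.ofAlg : A ⊗[ℂ] B →ₗ[ℂ] CStarTensor γ :=
  (UniformSpace.Completion.toComplL (𝕜 := ℂ) (E := PreAlg γ)).toLinearMap

theorem CStarTensor.norm_ofAlg (t : A ⊗[ℂ] B) : ‖CStarTensor.ofAlg γ t‖ = γ.toSeminorm t :=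
  UniformSpace.Completion.norm_coe (E := PreAlg γ) t

theorem CStarTensor.denseRange_ofAlg : DenseRange (CStarTensor.ofAlg γ) :=
  UniformSpace.Completion.denseRange_coe (α := PreAlg γ)

/-- Multiplication on `A ⊗_γ B`, the continuous extension of that of `A ⊙ B`. -/
noncomputable def CStarTensor.mulL : CStarTensor γ →L[ℂ] CStarTensor γ →L[ℂ] CStarTensor γ :=
  completion₂ (E := PreAlg γ) (F := PreAlg γ) (G := PreAlg γ) (LinearMap.mul ℂ (PreAlg γ))
    (PreAlg.norm_mul_le γ)

/-- Involution on `A ⊗_γ B`, the continuous extension of that of `A ⊙ B`. -/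
noncomputable def CStarTensor.starL : CStarTensor γ →L⋆[ℂ] CStarTensor γ :=
  ContinuousLinearMap.completion (α := PreAlg γ) (β := PreAlg γ)
    (LinearMap.mkContinuous (starLinearEquiv ℂ (A := PreAlg γ)).toLinearMap 1
      fun t => by simpa using (PreAlg.norm_star γ t).le)

noncomputable instance : Mul (CStarTensor γ) := ⟨fun s t => CStarTensor.mulL γ s t⟩
noncomputable instance : Star (CStarTensor γ) := ⟨fun t => CStarTensor.starL γ t⟩

@[simp] theorem CStarTensor.ofAlg_mul (s t : A ⊗[ℂ] B) :
    ofAlg γ (s * t) = ofAlg γ s * ofAlg γ t :=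
  (completion₂_coe (E := PreAlg γ) (F := PreAlg γ) (G := PreAlg γ) (LinearMap.mul ℂ (PreAlg γ))
    (PreAlg.norm_mul_le γ) s t).symm

@[simp] theorem CStarTensor.ofAlg_star (t : A ⊗[ℂ] B) :
    ofAlg γ (star t) = star (ofAlg γ t) :=
  (ContinuousLinearMap.completion_apply_coe (α := PreAlg γ) (β := PreAlg γ)
    (LinearMap.mkContinuous (starLinearEquiv ℂ (A := PreAlg γ)).toLinearMap 1
      fun t => by simpa using (PreAlg.norm_star γ t).le) t).symm

theorem CStarTensor.continuous_mul' : Continuous fun p : CStarTensor γ × CStarTensor γ =>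
    p.1 * p.2 := by
  change Continuous fun p : CStarTensor γ × CStarTensor γ => CStarTensor.mulL γ p.1 p.2
  fun_prop

instance : ContinuousMul (CStarTensor γ) := ⟨CStarTensor.continuous_mul' γ⟩

instance : ContinuousStar (CStarTensor γ) :=
  ⟨(CStarTensor.starL γ).continuous⟩

noncomputable instance : NonUnitalNormedRing (CStarTensor γ) where
  __ := (inferInstance : NormedAddCommGroup (CStarTensor γ))
  __ := (inferInstance : Mul (CStarTensor γ))
  left_distrib s t u := map_add (CStarTensor.mulL γ s) t u
  right_distrib s t u := by
    change CStarTensor.mulL γ (s + t) u = CStarTensor.mulL γ s u + CStarTensor.mulL γ t u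
    simp
  zero_mul s := by
    change CStarTensor.mulL γ 0 s = 0
    simp
  mul_zero s := map_zero (CStarTensor.mulL γ s)
  mul_assoc s t u := by
    refine (CStarTensor.denseRange_ofAlg γ).induction_on₃ ?_ ?_ s t u
    · exact isClosed_eq (by fun_prop) (by fun_prop)
    · intro s t u
      simp_rw [← CStarTensor.ofAlg_mul, mul_assoc]
  norm_mul_le s t := by
    refine (CStarTensor.denseRange_ofAlg γ).induction_on₂ (p := fun s t => ‖s * t‖ ≤ ‖s‖ * ‖t‖)
      ?_ ?_ s t
    · exact isClosed_le (by fun_prop) (by fun_prop)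
    · intro s t
      simp_rw [← CStarTensor.ofAlg_mul, CStarTensor.norm_ofAlg]
      exact γ.mul_le' s t

noncomputable instance : StarRing (CStarTensor γ) where
  star_involutive s := by
    refine (CStarTensor.denseRange_ofAlg γ).induction_on s ?_ ?_
    · exact isClosed_eq (by fun_prop) (by fun_prop)
    · intro s
      simp_rw [← CStarTensor.ofAlg_star, star_star]
  star_add s t := map_add (CStarTensor.starL γ) s t
  star_mul s t := by
    refine (CStarTensor.denseRange_ofAlg γ).induction_on₂
      (p := fun s t => star (s * t) = star t * star s) ?_ ?_ s t
    · exact isClosed_eq (by fun_prop) (by fun_prop)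
    · intro s t
      simp_rw [← CStarTensor.ofAlg_mul, ← CStarTensor.ofAlg_star, ← CStarTensor.ofAlg_mul,
        tensor_star_mul]

noncomputable instance : NonUnitalCStarAlgebra (CStarTensor γ) where
  norm_mul_self_le s := by
    refine (CStarTensor.denseRange_ofAlg γ).induction_on
      (p := fun s => ‖s‖ * ‖s‖ ≤ ‖star s * s‖) s ?_ ?_
    · exact isClosed_le (by fun_prop) (by fun_prop)
    · intro s
      simp_rw [← CStarTensor.ofAlg_star, ← CStarTensor.ofAlg_mul, CStarTensor.norm_ofAlg]
      exact (γ.star_mul_self' s).ge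
  smul_assoc c s t := by
    change CStarTensor.mulL γ (c • s) t = c • CStarTensor.mulL γ s t
    simp
  smul_comm c s t := ((CStarTensor.mulL γ s).map_smul c t).symm
  star_smul c s := (CStarTensor.starL γ).map_smulₛₗ c s

/-- `A ⊗_γ B` carries its usual order: the positive elements are the `s⋆ s`. -/
noncomputable instance : PartialOrder (CStarTensor γ) := CStarAlgebra.spectralOrder _
instance : StarOrderedRing (CStarTensor γ) := CStarAlgebra.spectralOrderedRing _

end Alg

section ExtTensor
variable {A B : Type*}
  [NonUnitalCStarAlgebra A] [PartialOrder A] [StarOrderedRing A]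
  [NonUnitalCStarAlgebra B] [PartialOrder B] [StarOrderedRing B]
  (γ : TensorCStarSeminorm A B)
  {X Y : Type*}
  [NormedAddCommGroup X] [NormedSpace ℂ X] [SMul A X] [CStarModule A X]
  [NormedAddCommGroup Y] [NormedSpace ℂ Y] [SMul B Y] [CStarModule B Y]

open CStarTensor

theorem ofAlg_inner_self_nonneg (t : X ⊗[ℂ] Y) : 0 ≤ ofAlg γ (algInner A B X Y t t) := by
  obtain ⟨n, w, hw⟩ := exists_algInner_self (A := A) (B := B) t
  rw [hw, map_sum]
  refine Finset.sum_nonneg fun k _ => ?_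
  rw [ofAlg_mul, ofAlg_star]
  exact mul_star_self_nonneg _

/-- The Cauchy-Schwarz inequality on `X ⊙ Y`. -/
theorem norm_algInner_sq_le (s t : X ⊗[ℂ] Y) :
    ‖ofAlg γ (algInner A B X Y s t)‖ ^ 2 ≤
      ‖ofAlg γ (algInner A B X Y s s)‖ * ‖ofAlg γ (algInner A B X Y t t)‖ := by
  set a := algInner A B X Y s t with ha
  have key : ∀ l : ℝ, 0 < l → ‖ofAlg γ (algInner A B X Y s s)‖ ≤ l →
      ‖ofAlg γ a‖ ^ 2 ≤ l * ‖ofAlg γ (algInner A B X Y t t)‖ := by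
    intro l hl hs
    have h0 := ofAlg_inner_self_nonneg γ (algAct A B X Y a s - (l : ℂ) • t)
    have h1 : algInner A B X Y (algAct A B X Y a s - (l : ℂ) • t)
        (algAct A B X Y a s - (l : ℂ) • t) =
        a * algInner A B X Y s s * star a - (l : ℂ) • (a * star a) - (l : ℂ) • (a * star a)
          + (l : ℂ) • (l : ℂ) • algInner A B X Y t t := by
      simp only [map_sub, LinearMap.sub_apply, map_smul, LinearMap.map_smulₛₗ,
        LinearMap.smul_apply, algInner_act_right, algInner_act_left, ← ha, Complex.conj_ofReal]
      rw [← star_algInner s t, ← ha, mul_assoc]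
      module
    rw [h1] at h0
    simp only [map_sub, map_add, map_smul, ofAlg_mul, ofAlg_star] at h0
    simp only [Complex.coe_smul] at h0
    have h2 : ofAlg γ a * ofAlg γ (algInner A B X Y s s) * star (ofAlg γ a) ≤
        l • (ofAlg γ a * star (ofAlg γ a)) :=
      (CStarAlgebra.star_right_conjugate_le_norm_smul
        (hb := IsSelfAdjoint.of_nonneg (ofAlg_inner_self_nonneg γ s))).trans
        (smul_le_smul_of_nonneg_right hs (mul_star_self_nonneg _))
    have h3 : l • (ofAlg γ a * star (ofAlg γ a)) ≤ l • l • ofAlg γ (algInner A B X Y t t) := by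
      rw [← sub_nonneg]
      refine h0.trans ?_
      rw [← sub_nonneg] at h2 ⊢
      convert h2 using 1
      abel
    have h4 : ofAlg γ a * star (ofAlg γ a) ≤ l • ofAlg γ (algInner A B X Y t t) :=
      (smul_le_smul_iff_of_pos_left hl).1 h3
    have h5 := CStarAlgebra.norm_le_norm_of_nonneg_of_le (mul_star_self_nonneg _) h4
    rwa [CStarRing.norm_self_mul_star, ← pow_two, norm_smul, Real.norm_of_nonneg hl.le] at h5
  set T := ‖ofAlg γ (algInner A B X Y t t)‖ with hT
  set S := ‖ofAlg γ (algInner A B X Y s s)‖ with hS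
  have hT0 : 0 ≤ T := norm_nonneg _
  have hS0 : 0 ≤ S := norm_nonneg _
  refine le_of_forall_pos_le_add fun ε hε => ?_
  have h6 := key (S + ε / (T + 1)) (by positivity) (le_add_of_nonneg_right (by positivity))
  refine h6.trans ?_
  have h7 : ε / (T + 1) * T ≤ ε := by
    rw [div_mul_eq_mul_div, div_le_iff₀ (by positivity)]
    nlinarith
  linarith [add_mul S (ε / (T + 1)) T]

/-- The seminorm `t ↦ γ(⟪t, t⟫)^{1/2}` on `X ⊙ Y`. -/
noncomputable def modSeminorm (X Y : Type*)
    [NormedAddCommGroup X] [NormedSpace ℂ X] [SMul A X] [CStarModule A X]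
    [NormedAddCommGroup Y] [NormedSpace ℂ Y] [SMul B Y] [CStarModule B Y] :
    Seminorm ℂ (X ⊗[ℂ] Y) :=
  Seminorm.of (fun t => √(γ.toSeminorm (algInner A B X Y t t)))
    (fun s t => by
      simp only [← norm_ofAlg]
      refine Real.sqrt_le_iff.2 ⟨by positivity, ?_⟩
      have h1 : ∀ s t : X ⊗[ℂ] Y, ‖ofAlg γ (algInner A B X Y s t)‖ ≤
          √‖ofAlg γ (algInner A B X Y s s)‖ * √‖ofAlg γ (algInner A B X Y t t)‖ := fun s t => by
        rw [← Real.sqrt_mul (norm_nonneg _)]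
        exact Real.le_sqrt_of_sq_le (norm_algInner_sq_le γ s t)
      have h2 := h1 s t
      have h3 := h1 t s
      have h4 := Real.sq_sqrt (norm_nonneg (ofAlg γ (algInner A B X Y s s)))
      have h5 := Real.sq_sqrt (norm_nonneg (ofAlg γ (algInner A B X Y t t)))
      simp only [map_add, LinearMap.add_apply]
      refine (norm_add_le _ _).trans ?_
      have h6 := norm_add_le (ofAlg γ (algInner A B X Y s s)) (ofAlg γ (algInner A B X Y t s))
      have h7 := norm_add_le (ofAlg γ (algInner A B X Y s t)) (ofAlg γ (algInner A B X Y t t))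
      nlinarith)
    (fun c t => by
      simp only [map_smul, LinearMap.map_smulₛₗ, LinearMap.smul_apply, map_smul_eq_mul]
      rw [← mul_assoc, RCLike.norm_conj, Real.sqrt_mul (by positivity), Real.sqrt_mul_self
        (norm_nonneg _)])

/-- The algebraic tensor product `X ⊙ Y`, regarded as a space with the seminorm induced by its
inner product and by `γ`. -/
@[nolint unusedArguments]
def PreMod (_γ : TensorCStarSeminorm A B) (X Y : Type*)
    [NormedAddCommGroup X] [NormedSpace ℂ X]
    [NormedAddCommGroup Y] [NormedSpace ℂ Y] : Type _ := X ⊗[ℂ] Y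

noncomputable instance : AddCommGroup (PreMod γ X Y) := inferInstanceAs (AddCommGroup (X ⊗[ℂ] Y))
noncomputable instance : Module ℂ (PreMod γ X Y) := inferInstanceAs (Module ℂ (X ⊗[ℂ] Y))

noncomputable instance : SeminormedAddCommGroup (PreMod γ X Y) :=
  AddGroupSeminorm.toSeminormedAddCommGroup (E := PreMod γ X Y)
    (modSeminorm γ X Y).toAddGroupSeminorm

noncomputable instance : NormedSpace ℂ (PreMod γ X Y) where
  norm_smul_le c t := ((modSeminorm γ X Y).smul' c t).le

theorem PreMod.norm_eq (t : PreMod γ X Y) : ‖t‖ = √‖ofAlg γ (algInner A B X Y t t)‖ := by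
  rw [norm_ofAlg]
  rfl

theorem PreMod.norm_inner_le (s t : PreMod γ X Y) :
    ‖(show PreAlg γ from algInner A B X Y s t)‖ ≤ ‖s‖ * ‖t‖ := by
  change γ.toSeminorm _ ≤ _
  rw [← norm_ofAlg, PreMod.norm_eq, PreMod.norm_eq, ← Real.sqrt_mul (norm_nonneg _)]
  exact Real.le_sqrt_of_sq_le (norm_algInner_sq_le γ s t)

theorem algAct_norm_le (a : A ⊗[ℂ] B) (t : X ⊗[ℂ] Y) :
    √‖ofAlg γ (algInner A B X Y (algAct A B X Y a t) (algAct A B X Y a t))‖ ≤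
      ‖ofAlg γ a‖ * √‖ofAlg γ (algInner A B X Y t t)‖ := by
  refine Real.sqrt_le_iff.2 ⟨by positivity, ?_⟩
  rw [algInner_act_right, algInner_act_left, ofAlg_mul, ofAlg_mul, ofAlg_star, mul_pow,
    Real.sq_sqrt (norm_nonneg _)]
  calc _ ≤ ‖ofAlg γ a‖ * (‖ofAlg γ (algInner A B X Y t t)‖ * ‖star (ofAlg γ a)‖) :=
        (norm_mul_le _ _).trans (mul_le_mul_of_nonneg_left (norm_mul_le _ _) (norm_nonneg _))
    _ = _ := by rw [norm_star]; ring

theorem PreMod.norm_act_le (a : PreAlg γ) (t : PreMod γ X Y) :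
    ‖(show PreMod γ X Y from algAct A B X Y a t)‖ ≤ ‖a‖ * ‖t‖ := by
  have ha : ‖a‖ = ‖ofAlg γ a‖ := (norm_ofAlg γ a).symm
  rw [PreMod.norm_eq, PreMod.norm_eq, ha]
  exact algAct_norm_le γ a t

/-- The external tensor product `X ⊗ Y` of a Hilbert `A`-module and a Hilbert `B`-module: the
(Hausdorff) completion of `X ⊙ Y`. It is a Hilbert module over `A ⊗_γ B`. -/
def ExtTensor (γ : TensorCStarSeminorm A B) (X Y : Type*)
    [NormedAddCommGroup X] [NormedSpace ℂ X] [SMul A X] [CStarModule A X]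
    [NormedAddCommGroup Y] [NormedSpace ℂ Y] [SMul B Y] [CStarModule B Y] : Type _ :=
  UniformSpace.Completion (PreMod γ X Y)

noncomputable instance : NormedAddCommGroup (ExtTensor γ X Y) :=
  inferInstanceAs (NormedAddCommGroup (UniformSpace.Completion (PreMod γ X Y)))
noncomputable instance : NormedSpace ℂ (ExtTensor γ X Y) :=
  inferInstanceAs (NormedSpace ℂ (UniformSpace.Completion (PreMod γ X Y)))
instance : CompleteSpace (ExtTensor γ X Y) :=
  inferInstanceAs (CompleteSpace (UniformSpace.Completion (PreMod γ X Y)))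

namespace ExtTensor

variable (X Y) in
/-- The canonical map `X ⊙ Y → X ⊗ Y`. -/
noncomputable def ofMod : X ⊗[ℂ] Y →ₗ[ℂ] ExtTensor γ X Y :=
  (UniformSpace.Completion.toComplL (𝕜 := ℂ) (E := PreMod γ X Y)).toLinearMap

theorem denseRange_ofMod : DenseRange (ofMod γ X Y) :=
  UniformSpace.Completion.denseRange_coe (α := PreMod γ X Y)

theorem norm_ofMod (t : X ⊗[ℂ] Y) :
    ‖ofMod γ X Y t‖ = √‖ofAlg γ (algInner A B X Y t t)‖ :=
  (UniformSpace.Completion.norm_coe (E := PreMod γ X Y) t).trans (PreMod.norm_eq γ t)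

/-- The elementary tensor `x ⊗ y` in `X ⊗ Y`. -/
noncomputable def tmul (x : X) (y : Y) : ExtTensor γ X Y := ofMod γ X Y (x ⊗ₜ y)

/-- The `A ⊗_γ B`-valued inner product on `X ⊗ Y`, extended by continuity. -/
noncomputable def innerL : ExtTensor γ X Y →L⋆[ℂ] ExtTensor γ X Y →L[ℂ] CStarTensor γ :=
  completion₂ (E := PreMod γ X Y) (F := PreMod γ X Y) (G := PreAlg γ) (algInner A B X Y)
    (PreMod.norm_inner_le γ)

/-- The action of `A ⊗_γ B` on `X ⊗ Y`, extended by continuity. -/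
noncomputable def smulL : CStarTensor γ →L[ℂ] ExtTensor γ X Y →L[ℂ] ExtTensor γ X Y :=
  completion₂ (E := PreAlg γ) (F := PreMod γ X Y) (G := PreMod γ X Y) (algAct A B X Y)
    (PreMod.norm_act_le γ)

theorem innerL_ofMod (s t : X ⊗[ℂ] Y) :
    innerL γ (ofMod γ X Y s) (ofMod γ X Y t) = ofAlg γ (algInner A B X Y s t) :=
  completion₂_coe (E := PreMod γ X Y) (F := PreMod γ X Y) (G := PreAlg γ) (algInner A B X Y)
    (PreMod.norm_inner_le γ) s t

theorem smulL_ofMod (c : A ⊗[ℂ] B) (t : X ⊗[ℂ] Y) :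
    smulL γ (ofAlg γ c) (ofMod γ X Y t) = ofMod γ X Y (algAct A B X Y c t) :=
  completion₂_coe (E := PreAlg γ) (F := PreMod γ X Y) (G := PreMod γ X Y) (algAct A B X Y)
    (PreMod.norm_act_le γ) c t

noncomputable instance : SMul (CStarTensor γ) (ExtTensor γ X Y) := ⟨fun c t => smulL γ c t⟩

theorem norm_eq_innerL (t : ExtTensor γ X Y) : ‖t‖ = √‖innerL γ t t‖ := by
  refine (denseRange_ofMod γ).induction_on (p := fun t : ExtTensor γ X Y => ‖t‖ = √‖innerL γ t t‖)
    t ?_ ?_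
  · exact isClosed_eq (by fun_prop) (by fun_prop)
  · intro t
    rw [innerL_ofMod, norm_ofMod]

noncomputable instance : CStarModule (CStarTensor γ) (ExtTensor γ X Y) where
  inner s t := innerL γ s t
  inner_add_right {s t u} := map_add (innerL γ s) t u
  inner_self_nonneg {t} := by
    refine (denseRange_ofMod γ).induction_on (p := fun t : ExtTensor γ X Y => 0 ≤ innerL γ t t)
      t ?_ ?_
    · exact isClosed_le (by fun_prop) (by fun_prop)
    · intro t
      rw [innerL_ofMod]
      exact ofAlg_inner_self_nonneg γ t
  inner_self {t} := by
    constructor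
    · intro h
      change innerL γ t t = 0 at h
      have := norm_eq_innerL γ t
      rw [h] at this
      simpa using this
    · rintro rfl
      exact map_zero (innerL γ 0)
  inner_op_smul_right {c s t} := by
    change innerL γ s (smulL γ c t) = c * innerL γ s t
    refine (denseRange_ofMod γ).induction_on₂
      (p := fun s t : ExtTensor γ X Y => innerL γ s (smulL γ c t) = c * innerL γ s t) ?_ ?_ s t
    · exact isClosed_eq (by fun_prop) (by fun_prop)
    · intro s t
      refine (denseRange_ofAlg γ).induction_on (p := fun c : CStarTensor γ =>
        innerL γ (ofMod γ X Y s) (smulL γ c (ofMod γ X Y t)) =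
          c * innerL γ (ofMod γ X Y s) (ofMod γ X Y t)) c ?_ ?_
      · exact isClosed_eq (by fun_prop) (by fun_prop)
      · intro c
        rw [smulL_ofMod, innerL_ofMod, innerL_ofMod, algInner_act_right, ofAlg_mul]
  inner_smul_right_complex {c s t} := map_smul (innerL γ s) c t
  star_inner s t := by
    change star (innerL γ s t) = innerL γ t s
    refine (denseRange_ofMod γ).induction_on₂
      (p := fun s t : ExtTensor γ X Y => star (innerL γ s t) = innerL γ t s) ?_ ?_ s t
    · exact isClosed_eq (by fun_prop) (by fun_prop)
    · intro s t
      rw [innerL_ofMod, innerL_ofMod, ← ofAlg_star, star_algInner]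
  norm_eq_sqrt_norm_inner_self t := norm_eq_innerL γ t

theorem inner_tmul (x x' : X) (y y' : Y) :
    inner (CStarTensor γ) (tmul γ x y) (tmul γ x' y') =
      ofAlg γ (inner A x x' ⊗ₜ inner B y y') :=
  (innerL_ofMod γ _ _).trans (by rw [algInner_tmul])

theorem smul_tmul (a : A) (b : B) (x : X) (y : Y) :
    ofAlg γ (a ⊗ₜ b) • tmul γ x y = tmul γ (a • x) (b • y) :=
  (smulL_ofMod γ _ _).trans (by rw [algAct_tmul]; rfl)

end ExtTensor
end ExtTensor

section Submodule
variable {A X : Type*} [NonUnitalCStarAlgebra A] [PartialOrder A] [StarOrderedRing A]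
  [NormedAddCommGroup X] [NormedSpace ℂ X] [SMul A X] [CStarModule A X]

variable (A X) in
/-- Closed `A`-submodules of a Hilbert `A`-module `X`. -/
structure HilbertSubmodule extends Submodule ℂ X where
  act_mem' : ∀ (a : A) (x : X), x ∈ carrier → a • x ∈ carrier
  isClosed' : IsClosed carrier

variable (A X) in
/-- The Hilbert module `X`, as a closed submodule of itself. -/
def HilbertSubmodule.whole : HilbertSubmodule A X where
  toSubmodule := ⊤
  act_mem' _ _ _ := trivial
  isClosed' := isClosed_univ

/-- `Y` is countably generated: it is the smallest closed submodule containing some countable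
set. -/
def HilbertSubmodule.CountablyGenerated (Y : HilbertSubmodule A X) : Prop :=
  ∃ S : Set X, S.Countable ∧ S ⊆ Y.carrier ∧
    ∀ Z : HilbertSubmodule A X, S ⊆ Z.carrier → Y.carrier ⊆ Z.carrier

variable (A) in
/-- `b` is a compact self-adjoint endomorphism of the Hilbert `A`-module `X`: it lies in the norm
closure of the linear span of the operators `θ_{x,y}`, and `⟪b x, y⟫ = ⟪x, b y⟫`. -/
def IsCompactSelfAdjoint (b : X →L[ℂ] X) : Prop :=
  b ∈ closure (Submodule.span ℂ {T : X →L[ℂ] X | ∃ x y : X, T = rankOne A x y} :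
    Set (X →L[ℂ] X)) ∧
  ∀ x y : X, inner A (b x) y = inner A x (b y)

/-- `b` witnesses the compact containment of `Y` in `X`: it is a compact self-adjoint endomorphism
of `X` which acts as the identity on `Y`. -/
def HilbertSubmodule.Witness (Y : HilbertSubmodule A X) (b : X →L[ℂ] X) : Prop :=
  IsCompactSelfAdjoint A b ∧ ∀ y ∈ Y.carrier, b y = y

/-- Compact containment `Y ⊂⊂ X` of countably generated Hilbert modules. -/
def HilbertSubmodule.CompactlyContained (Y : HilbertSubmodule A X) : Prop :=
  Y.CountablyGenerated ∧ (HilbertSubmodule.whole A X).CountablyGenerated ∧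
    ∃ b : X →L[ℂ] X, Y.Witness b

end Submodule

section TensorSubmodule
variable {A B : Type*}
  [NonUnitalCStarAlgebra A] [PartialOrder A] [StarOrderedRing A]
  [NonUnitalCStarAlgebra B] [PartialOrder B] [StarOrderedRing B]
  (γ : TensorCStarSeminorm A B)
  {X₁ X₂ : Type*}
  [NormedAddCommGroup X₁] [NormedSpace ℂ X₁] [SMul A X₁] [CStarModule A X₁]
  [NormedAddCommGroup X₂] [NormedSpace ℂ X₂] [SMul B X₂] [CStarModule B X₂]

/-- `Y₁ ⊗ Y₂` inside `X₁ ⊗ X₂`, for closed submodules `Y₁` of `X₁` and `Y₂` of `X₂`: the closure of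
the image of `Y₁ ⊙ Y₂`. As the inner product of `X₁ ⊗ X₂` restricts to that of `Y₁ ⊙ Y₂`, this is
the external tensor product of `Y₁` and `Y₂`. -/
noncomputable def HilbertSubmodule.tensor (Y₁ : HilbertSubmodule A X₁)
    (Y₂ : HilbertSubmodule B X₂) : HilbertSubmodule (CStarTensor γ) (ExtTensor γ X₁ X₂) where
  toSubmodule := ((LinearMap.range (TensorProduct.mapIncl Y₁.toSubmodule Y₂.toSubmodule)).map
    (ExtTensor.ofMod γ X₁ X₂)).topologicalClosure
  isClosed' := Submodule.isClosed_topologicalClosure _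
  act_mem' c u hu := by
    have hcont : Continuous (Function.uncurry fun (c : CStarTensor γ) (u : ExtTensor γ X₁ X₂) =>
        ExtTensor.smulL γ c u) := by
      unfold Function.uncurry
      fun_prop
    refine map_mem_closure₂ hcont (CStarTensor.denseRange_ofAlg γ c) hu ?_
    rintro _ ⟨c, rfl⟩ _ ⟨_, ⟨t, rfl⟩, rfl⟩
    change ExtTensor.smulL γ _ _ ∈ _
    rw [ExtTensor.smulL_ofMod]
    refine Submodule.mem_map_of_mem ?_
    induction c using TensorProduct.induction_on with
    | zero => simp
    | add c d hc hd => simpa using Submodule.add_mem _ hc hd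
    | tmul a b =>
      induction t using TensorProduct.induction_on with
      | zero => simp
      | add c d hc hd => simpa using Submodule.add_mem _ hc hd
      | tmul x y =>
        exact ⟨(⟨a • (x : X₁), Y₁.act_mem' a x x.2⟩ : Y₁.toSubmodule) ⊗ₜ[ℂ]
          (⟨b • (y : X₂), Y₂.act_mem' b y y.2⟩ : Y₂.toSubmodule), by simp⟩

end TensorSubmodule

section HilbertSpaces
variable (H K : Type*) [NormedAddCommGroup H] [InnerProductSpace ℂ H]
  [NormedAddCommGroup K] [InnerProductSpace ℂ K]

/-- The Hilbert space tensor product of `H` and `K`. -/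
def HilT : Type _ := UniformSpace.Completion (H ⊗[ℂ] K)

noncomputable instance : NormedAddCommGroup (HilT H K) :=
  inferInstanceAs (NormedAddCommGroup (UniformSpace.Completion (H ⊗[ℂ] K)))
noncomputable instance : InnerProductSpace ℂ (HilT H K) :=
  inferInstanceAs (InnerProductSpace ℂ (UniformSpace.Completion (H ⊗[ℂ] K)))
instance : CompleteSpace (HilT H K) :=
  inferInstanceAs (CompleteSpace (UniformSpace.Completion (H ⊗[ℂ] K)))

/-- The canonical map `H ⊙ K → H ⊗ K`. -/
noncomputable def HilT.of : H ⊗[ℂ] K →ₗ[ℂ] HilT H K :=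
  (UniformSpace.Completion.toComplL (𝕜 := ℂ) (E := H ⊗[ℂ] K)).toLinearMap

variable {H K}

theorem HilT.denseRange_of : DenseRange (HilT.of H K) :=
  UniformSpace.Completion.denseRange_coe (α := H ⊗[ℂ] K)

theorem HilT.norm_of (t : H ⊗[ℂ] K) : ‖HilT.of H K t‖ = ‖t‖ :=
  UniformSpace.Completion.norm_coe (E := H ⊗[ℂ] K) t

theorem HilT.inner_of (s t : H ⊗[ℂ] K) : inner ℂ (HilT.of H K s) (HilT.of H K t) = inner ℂ s t :=
  UniformSpace.Completion.inner_coe (E := H ⊗[ℂ] K) s t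

theorem HilT.ext {f g : HilT H K →L[ℂ] HilT H K}
    (h : ∀ x y, f (HilT.of H K (x ⊗ₜ y)) = g (HilT.of H K (x ⊗ₜ y))) : f = g := by
  ext z
  refine HilT.denseRange_of.induction_on (p := fun z => f z = g z) z
    (isClosed_eq f.continuous g.continuous) fun t => ?_
  induction t using TensorProduct.induction_on with
  | zero => simp
  | tmul x y => exact h x y
  | add s t hs ht => simp [hs, ht]

/-- The operator `f ⊗ g` on the Hilbert space `H ⊗ K`. -/
noncomputable def tensorOp (f : H →L[ℂ] H) (g : K →L[ℂ] K) : HilT H K →L[ℂ] HilT H K :=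
  (TensorProduct.mapL f g).completion

theorem tensorOp_of (f : H →L[ℂ] H) (g : K →L[ℂ] K) (t : H ⊗[ℂ] K) :
    tensorOp f g (HilT.of H K t) = HilT.of H K (TensorProduct.mapL f g t) :=
  ContinuousLinearMap.completion_apply_coe _ _

@[simp] theorem tensorOp_apply (f : H →L[ℂ] H) (g : K →L[ℂ] K) (x : H) (y : K) :
    tensorOp f g (HilT.of H K (x ⊗ₜ y)) = HilT.of H K (f x ⊗ₜ g y) := by
  simp [tensorOp_of]

theorem norm_tensorOp_le (f : H →L[ℂ] H) (g : K →L[ℂ] K) : ‖tensorOp f g‖ ≤ ‖f‖ * ‖g‖ := by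
  refine ContinuousLinearMap.opNorm_le_bound _ (by positivity) fun z => ?_
  refine HilT.denseRange_of.induction_on (p := fun z => ‖tensorOp f g z‖ ≤ ‖f‖ * ‖g‖ * ‖z‖) z
    (isClosed_le (by fun_prop) (by fun_prop)) fun t => ?_
  have h := TensorProduct.norm_mapL_le f g
  rw [tensorOp_of, HilT.norm_of, HilT.norm_of]
  exact (ContinuousLinearMap.le_opNorm _ _).trans (by gcongr)

theorem tensorOp_mul (f f' : H →L[ℂ] H) (g g' : K →L[ℂ] K) :
    tensorOp (f * f') (g * g') = tensorOp f g * tensorOp f' g' :=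
  HilT.ext fun x y => by simp

theorem tensorOp_star [CompleteSpace H] [CompleteSpace K] (f : H →L[ℂ] H) (g : K →L[ℂ] K) :
    tensorOp (star f) (star g) = star (tensorOp f g) := by
  rw [ContinuousLinearMap.star_eq_adjoint (tensorOp f g), ContinuousLinearMap.eq_adjoint_iff]
  intro u v
  refine HilT.denseRange_of.induction_on₂ (p := fun u v =>
    inner ℂ (tensorOp (star f) (star g) u) v = inner ℂ u (tensorOp f g v))
    (isClosed_eq (by fun_prop) (by fun_prop)) (fun s t => ?_) u v
  induction s using TensorProduct.induction_on with
  | zero => simp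
  | add s t hs ht => simp only [map_add, inner_add_left, hs, ht]
  | tmul h k =>
    induction t using TensorProduct.induction_on with
    | zero => simp
    | add s t hs ht => simp only [map_add, inner_add_right, hs, ht]
    | tmul h' k' =>
      simp [HilT.inner_of, ContinuousLinearMap.star_eq_adjoint,
        ContinuousLinearMap.adjoint_inner_left]

end HilbertSpaces

section Spatial
universe u v
variable (A : Type u) (B : Type v) [NonUnitalCStarAlgebra A] [NonUnitalCStarAlgebra B]

/-- A pair of Hilbert space representations, one of `A` and one of `B`. -/
structure RepPair where
  H : Type u
  K : Type v
  [instH : NormedAddCommGroup H]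
  [instH' : InnerProductSpace ℂ H]
  [instH'' : CompleteSpace H]
  [instK : NormedAddCommGroup K]
  [instK' : InnerProductSpace ℂ K]
  [instK'' : CompleteSpace K]
  π : A →⋆ₙₐ[ℂ] (H →L[ℂ] H)
  ρ : B →⋆ₙₐ[ℂ] (K →L[ℂ] K)

attribute [instance] RepPair.instH RepPair.instH' RepPair.instH'' RepPair.instK RepPair.instK'
  RepPair.instK''

variable {A B}

/-- The representation `π ⊗ ρ` of `A ⊙ B`: `a ⊗ b` acts as `π(a) ⊗ ρ(b)`. -/
noncomputable def RepPair.op (R : RepPair A B) :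
    A ⊗[ℂ] B →ₗ[ℂ] (HilT R.H R.K →L[ℂ] HilT R.H R.K) :=
  TensorProduct.lift <| LinearMap.mk₂ ℂ (fun a b => tensorOp (R.π a) (R.ρ b))
    (fun a a' b => HilT.ext fun x y => by simp [TensorProduct.add_tmul])
    (fun c a b => HilT.ext fun x y => by simp [← TensorProduct.smul_tmul'])
    (fun a b b' => HilT.ext fun x y => by simp [TensorProduct.tmul_add])
    (fun c a b => HilT.ext fun x y => by simp)

@[simp] theorem RepPair.op_tmul (R : RepPair A B) (a : A) (b : B) :
    R.op (a ⊗ₜ b) = tensorOp (R.π a) (R.ρ b) := by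
  simp [RepPair.op]

theorem RepPair.op_mul (R : RepPair A B) (s t : A ⊗[ℂ] B) : R.op (s * t) = R.op s * R.op t := by
  induction s using TensorProduct.induction_on with
  | zero => simp
  | add x y hx hy => simp [add_mul, hx, hy]
  | tmul a b =>
    induction t using TensorProduct.induction_on with
    | zero => simp
    | add x y hx hy => simp [mul_add, hx, hy]
    | tmul c d => simp [tensorOp_mul]

theorem RepPair.op_star (R : RepPair A B) (t : A ⊗[ℂ] B) : R.op (star t) = star (R.op t) := by
  induction t using TensorProduct.induction_on with
  | zero => simp
  | add s t hs ht => simp [hs, ht]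
  | tmul a b => simp [map_star, tensorOp_star]

theorem RepPair.exists_bound (t : A ⊗[ℂ] B) : ∃ C : ℝ, ∀ R : RepPair A B, ‖R.op t‖ ≤ C := by
  induction t using TensorProduct.induction_on with
  | zero => exact ⟨0, fun R => by simp⟩
  | add s t hs ht =>
    obtain ⟨C, hC⟩ := hs
    obtain ⟨D, hD⟩ := ht
    refine ⟨C + D, fun R => ?_⟩
    rw [map_add]
    exact (norm_add_le _ _).trans (add_le_add (hC R) (hD R))
  | tmul a b =>
    refine ⟨‖a‖ * ‖b‖, fun R => ?_⟩
    rw [R.op_tmul]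
    refine (norm_tensorOp_le _ _).trans ?_
    gcongr
    · exact NonUnitalStarAlgHom.norm_apply_le R.π a
    · exact NonUnitalStarAlgHom.norm_apply_le R.ρ b

theorem RepPair.le_iSup (t : A ⊗[ℂ] B) (R : RepPair A B) :
    ‖R.op t‖ ≤ ⨆ R : RepPair A B, ‖R.op t‖ := by
  obtain ⟨C, hC⟩ := RepPair.exists_bound t
  refine le_ciSup (f := fun R : RepPair A B => ‖R.op t‖) ⟨C, ?_⟩ R
  rintro _ ⟨R, rfl⟩
  exact hC R

theorem RepPair.iSup_nonneg (t : A ⊗[ℂ] B) : 0 ≤ ⨆ R : RepPair A B, ‖R.op t‖ :=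
  Real.iSup_nonneg fun _ => norm_nonneg _

variable (A B) in
/-- The spatial (minimal) C⋆-norm on `A ⊙ B`: the supremum of `‖(π ⊗ ρ)(t)‖` over all
representations `π` of `A` and `ρ` of `B` on Hilbert spaces. -/
noncomputable def spatial : TensorCStarSeminorm A B where
  toSeminorm := Seminorm.of (fun t => ⨆ R : RepPair A B, ‖R.op t‖)
    (fun s t => Real.iSup_le (fun R => by
        rw [map_add]
        exact (norm_add_le _ _).trans (add_le_add (RepPair.le_iSup s R) (RepPair.le_iSup t R)))
      (add_nonneg (RepPair.iSup_nonneg s) (RepPair.iSup_nonneg t)))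
    (fun c t => by
      rw [Real.mul_iSup_of_nonneg (norm_nonneg c)]
      congr 1
      ext R
      rw [map_smul, norm_smul])
  mul_le' s t := Real.iSup_le (fun R => by
      rw [R.op_mul]
      exact (norm_mul_le _ _).trans (mul_le_mul (RepPair.le_iSup s R) (RepPair.le_iSup t R)
        (norm_nonneg _) (RepPair.iSup_nonneg s)))
    (mul_nonneg (RepPair.iSup_nonneg s) (RepPair.iSup_nonneg t))
  star_mul_self' t := by
    have h : ∀ R : RepPair A B, ‖R.op (star t * t)‖ = ‖R.op t‖ * ‖R.op t‖ := fun R => by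
      rw [R.op_mul, R.op_star, CStarRing.norm_star_mul_self]
    have h0 := RepPair.iSup_nonneg t
    apply le_antisymm
    · refine Real.iSup_le (fun R => ?_) (mul_nonneg h0 h0)
      rw [h]
      exact mul_le_mul (RepPair.le_iSup t R) (RepPair.le_iSup t R) (norm_nonneg _) h0
    · have h4 : (⨆ R : RepPair A B, ‖R.op t‖) ≤ √(⨆ R : RepPair A B, ‖R.op (star t * t)‖) :=
        Real.iSup_le (fun R => Real.le_sqrt_of_sq_le <| by
          rw [pow_two, ← h]
          exact RepPair.le_iSup (star t * t) R) (Real.sqrt_nonneg _)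
      calc _ ≤ √(⨆ R : RepPair A B, ‖R.op (star t * t)‖) *
            √(⨆ R : RepPair A B, ‖R.op (star t * t)‖) :=
            mul_le_mul h4 h4 h0 (Real.sqrt_nonneg _)
        _ = _ := Real.mul_self_sqrt (RepPair.iSup_nonneg _)

end Spatial
end HilbertTensor

/-! The witness is `b₁ ⊗ b₂`; the two substantial points are that this operator is bounded and that
countable generation passes to tensor products.

Boundedness. An adjointable `f` satisfies `⟪f x, f x⟫ ≤ ‖f‖² ⟪x, x⟫` (`IsAdjointable.inner_map_le`).
Applied to all `A`-linear combinations of `x₁, …, xₙ`, this says that the matrix `‖f‖² ⟪xᵢ, xⱼ⟫ - ⟪f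
xᵢ, f xⱼ⟫` is positive, so it factors like a Gram matrix. For `t = ∑ xᵢ ⊗ yᵢ` the element `‖f‖² ⟪t,
t⟫ - ⟪(f ⊗ 1) t, (f ⊗ 1) t⟫` is the sum of the entries of the Schur product of that matrix with the
Gram matrix of the `yᵢ`. This sum is positive (`ofAlg_sum_gram_nonneg`), whence `‖f ⊗ 1‖ ≤ ‖f‖`. The
other leg is symmetric, and `‖f ⊗ g‖ ≤ ‖f‖ ‖g‖`.

Witness. On rank one operators `θ_{x,y} ⊗ θ_{x',y'} = θ_{x ⊗ x', y ⊗ y'}`, so tensor products of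
finite rank operators have finite rank, and the norm bound carries this to norm limits.
Self-adjointness and the identity on `Y₁ ⊗ Y₂` are closed additive conditions, checked on elementary
tensors.

Countable generation. If `S` and `T` generate `Y₁` and `Y₂`, the vectors `s ⊗ t` generate `Y₁ ⊗ Y₂`.
As `A` alone does not act on `X₁ ⊗ X₂`, the vector `a x ⊗ y` is reached as the limit of `(a ⊗ e)(x ⊗
y)` along an approximate unit `e` of `B`; this needs `x ⊗ y` to be separately continuous. -/

namespace HilbertTensor

open Filter Topology

set_option linter.unusedSectionVars false

/-! ### Adjointable operators on a Hilbert module and their basic inequality -/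

section Adjointable
variable {A X : Type*} [NonUnitalCStarAlgebra A] [PartialOrder A] [StarOrderedRing A]
  [NormedAddCommGroup X] [NormedSpace ℂ X] [SMul A X] [CStarModule A X]

variable (A) in
/-- A bounded operator on a Hilbert module which has an adjoint. -/
def IsAdjointable (f : X →L[ℂ] X) : Prop :=
  ∃ g : X →L[ℂ] X, ∀ x y : X, inner A (f x) y = inner A x (g y)

theorem inner_swap_of_adjoint {f g : X →L[ℂ] X}
    (h : ∀ x y : X, inner A (f x) y = inner A x (g y)) (x y : X) :
    inner A (g x) y = inner A x (f y) := by
  rw [← CStarModule.star_inner, ← h, CStarModule.star_inner]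

/-- Moving `f` to the other side of the inner product turns the claim into linearity of `⟪g z, ·⟫`
over `A`. It lets `f` pass through the combinations `∑ vⱼ • xⱼ` that test positivity of a matrix
over `A`. -/
theorem IsAdjointable.map_act {f : X →L[ℂ] X} (hf : IsAdjointable A f) (a : A) (x : X) :
    f (a • x) = a • f x := by
  obtain ⟨g, hg⟩ := hf
  refine ext_inner A fun z => ?_
  simp [← inner_swap_of_adjoint hg]

theorem IsAdjointable.of_selfAdjoint {f : X →L[ℂ] X}
    (h : ∀ x y : X, inner A (f x) y = inner A x (f y)) : IsAdjointable A f := ⟨f, h⟩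

theorem IsAdjointable.zero : IsAdjointable A (0 : X →L[ℂ] X) := ⟨0, by simp⟩

theorem IsAdjointable.add {f g : X →L[ℂ] X} (hf : IsAdjointable A f) (hg : IsAdjointable A g) :
    IsAdjointable A (f + g) := by
  obtain ⟨f', hf⟩ := hf
  obtain ⟨g', hg⟩ := hg
  exact ⟨f' + g', by simp [hf, hg]⟩

theorem IsAdjointable.smul (c : ℂ) {f : X →L[ℂ] X} (hf : IsAdjointable A f) :
    IsAdjointable A (c • f) := by
  obtain ⟨f', hf⟩ := hf
  exact ⟨star c • f', by simp [hf]⟩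

theorem IsAdjointable.sub {f g : X →L[ℂ] X} (hf : IsAdjointable A f) (hg : IsAdjointable A g) :
    IsAdjointable A (f - g) := by
  obtain ⟨f', hf⟩ := hf
  obtain ⟨g', hg⟩ := hg
  exact ⟨f' - g', by simp [hf, hg]⟩

theorem IsAdjointable.rankOne (x y : X) : IsAdjointable A (rankOne A x y) :=
  ⟨HilbertTensor.rankOne A y x, fun u v => by simp⟩

variable (A X) in
/-- The span of the elementary operators on a Hilbert module. -/
abbrev finiteRank : Submodule ℂ (X →L[ℂ] X) :=
  Submodule.span ℂ {T : X →L[ℂ] X | ∃ x y : X, T = rankOne A x y}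

theorem IsAdjointable.of_mem_finiteRank {f : X →L[ℂ] X} (hf : f ∈ finiteRank A X) :
    IsAdjointable A f := by
  induction hf using Submodule.span_induction with
  | mem f hf => obtain ⟨x, y, rfl⟩ := hf; exact .rankOne x y
  | zero => exact .zero
  | add f g _ _ hf hg => exact hf.add hg
  | smul c f _ hf => exact hf.smul c

/-- Expansion of `0 ≤ ⟪x - S x, x - S x⟫`. -/
theorem two_smul_inner_le {S : X →L[ℂ] X}
    (hS : ∀ x y : X, inner A (S x) y = inner A x (S y)) (x : X) :
    (2 : ℝ) • inner A x (S x) ≤ inner A x x + inner A x (S (S x)) := by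
  have h : 0 ≤ inner A (x - S x) (x - S x) := CStarModule.inner_self_nonneg
  rw [← sub_nonneg]
  convert h using 1
  simp only [CStarModule.inner_sub_left, CStarModule.inner_sub_right, hS, two_smul]
  abel

/-- Repeated squaring: the induction hypothesis is used for `S ^ 2`, which is again self-adjoint,
and combined with `2ⁿ` times the preceding inequality for `S`. -/
theorem inner_selfAdjoint_le_pow (n : ℕ) {S : X →L[ℂ] X}
    (hS : ∀ x y : X, inner A (S x) y = inner A x (S y)) (x : X) :
    (2 ^ n : ℝ) • inner A x (S x) ≤ (2 ^ n - 1 : ℝ) • inner A x x + inner A x ((S ^ 2 ^ n) x) := by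
  induction n generalizing S with
  | zero => simp
  | succ n ih =>
    have hS2 : ∀ x y : X, inner A ((S ^ 2) x) y = inner A x ((S ^ 2) y) := fun x y => by
      simp [pow_two, hS]
    have h1 := smul_le_smul_of_nonneg_left (two_smul_inner_le hS x)
      (show (0 : ℝ) ≤ 2 ^ n by positivity)
    have h2 := ih hS2
    rw [← pow_mul, ← pow_succ', pow_two] at h2
    calc (2 ^ (n + 1) : ℝ) • inner A x (S x) = (2 ^ n : ℝ) • (2 : ℝ) • inner A x (S x) := by
          rw [smul_smul, pow_succ]
      _ ≤ _ := h1
      _ = (2 ^ n : ℝ) • inner A x x + (2 ^ n : ℝ) • inner A x ((S * S) x) := by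
          rw [smul_add]; rfl
      _ ≤ (2 ^ n : ℝ) • inner A x x + ((2 ^ n - 1 : ℝ) • inner A x x +
            inner A x ((S ^ 2 ^ (n + 1)) x)) := by gcongr
      _ = _ := by rw [← add_assoc, ← add_smul]; congr 2; ring

/-- Divide the preceding inequality by `2ⁿ` and let `n → ∞`: the powers of a contraction stay
bounded, so the last term vanishes. The argument uses neither functional calculus for operators nor
completeness of `X`. -/
theorem inner_selfAdjoint_le {S : X →L[ℂ] X}
    (hS : ∀ x y : X, inner A (S x) y = inner A x (S y)) (h1 : ‖S‖ ≤ 1) (x : X) :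
    inner A x (S x) ≤ inner A x x := by
  have h2 : Tendsto (fun n : ℕ => (2⁻¹ : ℝ) ^ n) atTop (𝓝 0) :=
    tendsto_pow_atTop_nhds_zero_of_lt_one (by norm_num) (by norm_num)
  have h3 : Tendsto (fun n : ℕ => (2⁻¹ : ℝ) ^ n • inner A x ((S ^ 2 ^ n) x)) atTop (𝓝 0) := by
    refine squeeze_zero_norm (a := fun n : ℕ => (2⁻¹ : ℝ) ^ n * (‖x‖ * ‖x‖)) (fun n => ?_)
      (by simpa using h2.mul_const (‖x‖ * ‖x‖))
    rw [norm_smul, Real.norm_of_nonneg (by positivity)]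
    gcongr
    refine (CStarModule.norm_inner_le X).trans ?_
    gcongr
    refine ((S ^ 2 ^ n).le_opNorm x).trans ?_
    refine mul_le_of_le_one_left (norm_nonneg _) ?_
    exact (norm_pow_le' S (by positivity)).trans (pow_le_one₀ (norm_nonneg _) h1)
  have h4 : Tendsto (fun n : ℕ => (1 - (2⁻¹ : ℝ) ^ n) • inner A x x +
      (2⁻¹ : ℝ) ^ n • inner A x ((S ^ 2 ^ n) x)) atTop (𝓝 (inner A x x)) := by
    simpa using ((h2.const_sub 1).smul_const (inner A x x)).add h3
  refine ge_of_tendsto' h4 fun n => ?_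
  have h5 := smul_le_smul_of_nonneg_left (inner_selfAdjoint_le_pow n hS x)
    (show (0 : ℝ) ≤ 2⁻¹ ^ n by positivity)
  rw [smul_add, smul_smul, smul_smul, mul_sub, ← mul_pow, inv_mul_cancel₀ two_ne_zero, one_pow,
    one_smul, mul_one] at h5
  exact h5

theorem norm_adjoint_le {f g : X →L[ℂ] X}
    (h : ∀ x y : X, inner A (f x) y = inner A x (g y)) : ‖g‖ ≤ ‖f‖ := by
  refine g.opNorm_le_bound (norm_nonneg _) fun x => ?_
  have h1 : ‖g x‖ ^ 2 ≤ ‖f‖ * ‖g x‖ * ‖x‖ := by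
    -- `⟪g x, g x⟫ = ⟪f (g x), x⟫`, to which Cauchy-Schwarz applies.
    rw [CStarModule.norm_sq_eq A, ← h]
    exact (CStarModule.norm_inner_le X).trans (by gcongr; exact f.le_opNorm _)
  rcases (norm_nonneg (g x)).eq_or_lt with h0 | h0
  · rw [← h0]; positivity
  · nlinarith

/-- An adjointable operator satisfies `⟪f x, f x⟫ ≤ ‖f‖² ⟪x, x⟫`. -/
theorem IsAdjointable.inner_map_le {f : X →L[ℂ] X} (hf : IsAdjointable A f) (x : X) :
    inner A (f x) (f x) ≤ (‖f‖ ^ 2) • inner A x x := by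
  obtain ⟨g, hg⟩ := hf
  rcases eq_or_ne f 0 with rfl | h0
  · simp
  have hc : 0 < ‖f‖ := norm_pos_iff.2 h0
  -- `‖f‖⁻² g f` is a self-adjoint contraction, and `⟪x, g (f x)⟫ = ⟪f x, f x⟫`.
  have h1 := inner_selfAdjoint_le (A := A) (S := ((‖f‖ ^ 2)⁻¹ : ℝ) • (g * f))
    (fun x y => by simp [hg, inner_swap_of_adjoint hg]) (by
      rw [norm_smul, Real.norm_of_nonneg (by positivity), inv_mul_le_one₀ (by positivity), pow_two]
      exact (norm_mul_le _ _).trans (by gcongr; exact norm_adjoint_le hg)) x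
  have h2 := smul_le_smul_of_nonneg_left h1 (show 0 ≤ ‖f‖ ^ 2 by positivity)
  simpa [smul_smul, hc.ne', hg] using h2

theorem IsAdjointable.exists_gram_sub {f : X →L[ℂ] X} (hf : IsAdjointable A f) {n : Type*}
    [Fintype n] (x : n → X) : ∃ c : n → n → A, ∀ i j,
      (‖f‖ ^ 2) • inner A (x i) (x j) - inner A (f (x i)) (f (x j)) =
        ∑ k, c j k * star (c i k) := by
  -- The inner product is conjugate-linear in its first variable, so `vᵢ` appears on the left and
  -- `star vⱼ` on the right of `⟪xⱼ, xᵢ⟫`; hence the transposed indices.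
  obtain ⟨c, hc⟩ := exists_matrix_factor
    (fun i j => (‖f‖ ^ 2) • inner A (x j) (x i) - inner A (f (x j)) (f (x i))) (by simp) fun v => by
    have := sub_nonneg.2 (hf.inner_map_le (∑ j, v j • x j))
    simpa [hf.map_act, Finset.mul_sum, Finset.smul_sum, mul_assoc, mul_sub, sub_mul,
      smul_mul_assoc, mul_smul_comm] using this
  exact ⟨c, fun i j => hc j i⟩

end Adjointable

/-! ### Norm bound for `f ⊗ g` on the algebraic tensor product -/

section Positivity
variable {A B X Y : Type*}
  [NonUnitalCStarAlgebra A] [PartialOrder A] [StarOrderedRing A]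
  [NormedAddCommGroup X] [NormedSpace ℂ X] [SMul A X] [CStarModule A X]
  [NonUnitalCStarAlgebra B] [PartialOrder B] [StarOrderedRing B]
  [NormedAddCommGroup Y] [NormedSpace ℂ Y] [SMul B Y] [CStarModule B Y]
  (γ : TensorCStarSeminorm A B)

open CStarTensor

theorem exists_fin_sum_tmul (t : X ⊗[ℂ] Y) :
    ∃ (n : ℕ) (x : Fin n → X) (y : Fin n → Y), t = ∑ i, x i ⊗ₜ[ℂ] y i := by
  induction t using TensorProduct.induction_on with
  | zero => exact ⟨0, fun _ => 0, fun _ => 0, by simp⟩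
  | tmul x y => exact ⟨1, fun _ => x, fun _ => y, by simp⟩
  | add s t hs ht =>
    obtain ⟨n, x, y, rfl⟩ := hs
    obtain ⟨m, x', y', rfl⟩ := ht
    exact ⟨n + m, Fin.append x x', Fin.append y y', by simp [Fin.sum_univ_add]⟩

/-- The Schur product of two positive matrices has a positive sum of entries. -/
theorem ofAlg_sum_gram_nonneg {n : Type*} [Fintype n] (c : n → n → A) (d : n → n → B) :
    0 ≤ ofAlg γ (∑ i, ∑ j,
      (∑ k, c j k * star (c i k)) ⊗ₜ[ℂ] (∑ l, d j l * star (d i l))) := by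
  have h : ∑ i, ∑ j, (∑ k, c j k * star (c i k)) ⊗ₜ[ℂ] (∑ l, d j l * star (d i l)) =
      ∑ k, ∑ l, (∑ j, c j k ⊗ₜ[ℂ] d j l) * star (∑ i, c i k ⊗ₜ[ℂ] d i l) := by
    simp only [star_sum, TensorProduct.star_tmul, Finset.sum_mul_sum,
      Algebra.TensorProduct.tmul_mul_tmul, TensorProduct.sum_tmul, TensorProduct.tmul_sum]
    simp only [← Finset.sum_product', Finset.univ_product_univ]
    -- Both sides are sums over quadruples of indices, and reversing the quadruple matches them.
    refine Fintype.sum_equiv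
      ⟨fun p => (p.2.2.2, p.2.2.1, p.2.1, p.1), fun p => (p.2.2.2, p.2.2.1, p.2.1, p.1),
        fun _ => rfl, fun _ => rfl⟩ _ _ fun p => rfl
  rw [h]
  simp only [map_sum, ofAlg_mul, ofAlg_star]
  exact Finset.sum_nonneg fun k _ => Finset.sum_nonneg fun l _ => by
    simpa using mul_star_self_nonneg (∑ j, ofAlg γ (c j k ⊗ₜ[ℂ] d j l))

/-- The C⋆-norm is monotone on positive elements, so an operator inequality between `⟪s, s⟫` and
`⟪t, t⟫` becomes a norm inequality. -/
theorem norm_ofMod_le_of_nonneg_sub {c : ℝ} (hc : 0 ≤ c) {s t : X ⊗[ℂ] Y}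
    (h : 0 ≤ ofAlg γ (((c ^ 2 : ℝ) : ℂ) • algInner A B X Y t t - algInner A B X Y s s)) :
    ‖ExtTensor.ofMod γ X Y s‖ ≤ c * ‖ExtTensor.ofMod γ X Y t‖ := by
  rw [ExtTensor.norm_ofMod, ExtTensor.norm_ofMod]
  refine Real.sqrt_le_iff.2 ⟨by positivity, ?_⟩
  rw [mul_pow, Real.sq_sqrt (norm_nonneg _)]
  rw [map_sub, sub_nonneg] at h
  refine (CStarAlgebra.norm_le_norm_of_nonneg_of_le (ofAlg_inner_self_nonneg γ s) h).trans_eq ?_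
  rw [map_smul, norm_smul, Complex.norm_real, Real.norm_of_nonneg (by positivity)]

/-- The defect `‖f‖² ⟪t, t⟫ - ⟪(f ⊗ 1) t, (f ⊗ 1) t⟫` is the sum of the entries of a Schur product
of two factored matrices: the defect matrix of `f` at the `xᵢ` and the Gram matrix of the `yᵢ`. -/
theorem norm_ofMod_rTensor_le {f : X →L[ℂ] X} (hf : IsAdjointable A f) (t : X ⊗[ℂ] Y) :
    ‖ExtTensor.ofMod γ X Y (f.toLinearMap.rTensor Y t)‖ ≤ ‖f‖ * ‖ExtTensor.ofMod γ X Y t‖ := by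
  refine norm_ofMod_le_of_nonneg_sub γ (norm_nonneg _) ?_
  obtain ⟨n, x, y, rfl⟩ := exists_fin_sum_tmul t
  obtain ⟨c, hc⟩ := hf.exists_gram_sub x
  simp only [← Complex.coe_smul] at hc
  obtain ⟨d, hd⟩ := exists_gram (A := B) y
  convert ofAlg_sum_gram_nonneg γ c d using 2
  simp only [map_sum, LinearMap.sum_apply, LinearMap.rTensor_tmul, algInner_tmul, ← hc, ← hd,
    TensorProduct.sub_tmul, Finset.sum_sub_distrib, Finset.smul_sum, TensorProduct.smul_tmul',
    ContinuousLinearMap.coe_coe]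
  congr 1 <;> exact Finset.sum_comm

theorem norm_ofMod_lTensor_le {g : Y →L[ℂ] Y} (hg : IsAdjointable B g) (t : X ⊗[ℂ] Y) :
    ‖ExtTensor.ofMod γ X Y (g.toLinearMap.lTensor X t)‖ ≤ ‖g‖ * ‖ExtTensor.ofMod γ X Y t‖ := by
  refine norm_ofMod_le_of_nonneg_sub γ (norm_nonneg _) ?_
  obtain ⟨n, x, y, rfl⟩ := exists_fin_sum_tmul t
  obtain ⟨c, hc⟩ := exists_gram (A := A) x
  obtain ⟨d, hd⟩ := hg.exists_gram_sub y
  simp only [← Complex.coe_smul] at hd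
  convert ofAlg_sum_gram_nonneg γ c d using 2
  simp only [map_sum, LinearMap.sum_apply, LinearMap.lTensor_tmul, algInner_tmul, ← hc, ← hd,
    TensorProduct.tmul_sub, Finset.sum_sub_distrib, Finset.smul_sum, TensorProduct.tmul_smul,
    ContinuousLinearMap.coe_coe]
  congr 1 <;> exact Finset.sum_comm

theorem norm_ofMod_map_le {f : X →L[ℂ] X} (hf : IsAdjointable A f) {g : Y →L[ℂ] Y}
    (hg : IsAdjointable B g) (t : X ⊗[ℂ] Y) :
    ‖ExtTensor.ofMod γ X Y (TensorProduct.map f.toLinearMap g.toLinearMap t)‖ ≤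
      ‖f‖ * ‖g‖ * ‖ExtTensor.ofMod γ X Y t‖ := by
  rw [← LinearMap.rTensor_comp_lTensor, LinearMap.comp_apply, mul_assoc]
  exact (norm_ofMod_rTensor_le γ hf _).trans
    (mul_le_mul_of_nonneg_left (norm_ofMod_lTensor_le γ hg t) (norm_nonneg _))

end Positivity

/-! ### The operator `f ⊗ g` on the completion: compactness and adjoints -/

section Map
variable {A B X Y : Type*}
  [NonUnitalCStarAlgebra A] [PartialOrder A] [StarOrderedRing A]
  [NormedAddCommGroup X] [NormedSpace ℂ X] [SMul A X] [CStarModule A X]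
  [NonUnitalCStarAlgebra B] [PartialOrder B] [StarOrderedRing B]
  [NormedAddCommGroup Y] [NormedSpace ℂ Y] [SMul B Y] [CStarModule B Y]
  (γ : TensorCStarSeminorm A B)

namespace ExtTensor
open CStarTensor

/-- The operator `f ⊗ g` on `X ⊗ Y`, for adjointable `f` and `g`. -/
noncomputable def mapL {f : X →L[ℂ] X} (hf : IsAdjointable A f) {g : Y →L[ℂ] Y}
    (hg : IsAdjointable B g) : ExtTensor γ X Y →L[ℂ] ExtTensor γ X Y :=
  ContinuousLinearMap.completion (α := PreMod γ X Y) (β := PreMod γ X Y)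
    (LinearMap.mkContinuous (σ := .id ℂ) (E := PreMod γ X Y) (F := PreMod γ X Y)
      (TensorProduct.map f.toLinearMap g.toLinearMap) (‖f‖ * ‖g‖) fun t => by
        -- The bound is known for images in the completion, but is required for the seminorm before
        -- completing; `e` identifies the two.
        have e (s : X ⊗[ℂ] Y) : ‖ofMod γ X Y s‖ = ‖(show PreMod γ X Y from s)‖ :=
          UniformSpace.Completion.norm_coe (E := PreMod γ X Y) s
        exact (e _).symm.trans_le ((norm_ofMod_map_le γ hf hg t).trans_eq (congrArg _ (e t))))

theorem mapL_ofMod {f : X →L[ℂ] X} (hf : IsAdjointable A f) {g : Y →L[ℂ] Y}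
    (hg : IsAdjointable B g) (t : X ⊗[ℂ] Y) :
    mapL γ hf hg (ofMod γ X Y t) =
      ofMod γ X Y (TensorProduct.map f.toLinearMap g.toLinearMap t) :=
  ContinuousLinearMap.completion_apply_coe (α := PreMod γ X Y) (β := PreMod γ X Y) _ _

@[simp] theorem mapL_tmul {f : X →L[ℂ] X} (hf : IsAdjointable A f) {g : Y →L[ℂ] Y}
    (hg : IsAdjointable B g) (x : X) (y : Y) : mapL γ hf hg (tmul γ x y) = tmul γ (f x) (g y) :=
  mapL_ofMod γ hf hg _

theorem norm_mapL_le {f : X →L[ℂ] X} (hf : IsAdjointable A f) {g : Y →L[ℂ] Y}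
    (hg : IsAdjointable B g) : ‖mapL γ hf hg‖ ≤ ‖f‖ * ‖g‖ := by
  refine ContinuousLinearMap.opNorm_le_bound _ (by positivity) fun z => ?_
  refine (denseRange_ofMod γ).induction_on
    (p := fun z => ‖mapL γ hf hg z‖ ≤ ‖f‖ * ‖g‖ * ‖z‖) z
    (isClosed_le (by fun_prop) (by fun_prop)) fun t => ?_
  rw [mapL_ofMod]
  exact norm_ofMod_map_le γ hf hg t

theorem induction_on {p : ExtTensor γ X Y → Prop} (z : ExtTensor γ X Y)
    (hc : IsClosed {z | p z}) (h0 : p 0) (hadd : ∀ s t, p s → p t → p (s + t))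
    (ht : ∀ x y, p (tmul γ x y)) : p z := by
  refine (denseRange_ofMod γ).induction_on z hc fun t => ?_
  induction t using TensorProduct.induction_on with
  | zero => rwa [map_zero]
  | tmul x y => exact ht x y
  | add s t hs ht => rw [map_add]; exact hadd _ _ hs ht

theorem ext_tmul {f g : ExtTensor γ X Y →L[ℂ] ExtTensor γ X Y}
    (h : ∀ x y, f (tmul γ x y) = g (tmul γ x y)) : f = g := by
  ext z
  exact induction_on γ (p := fun z => f z = g z) z (isClosed_eq f.continuous g.continuous)
    (by simp) (fun s t hs ht => by simp [hs, ht]) h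

theorem tmul_add (x : X) (y y' : Y) : tmul γ x (y + y') = tmul γ x y + tmul γ x y' := by
  simp [tmul, TensorProduct.tmul_add]

theorem add_tmul (x x' : X) (y : Y) : tmul γ (x + x') y = tmul γ x y + tmul γ x' y := by
  simp [tmul, TensorProduct.add_tmul]

theorem tmul_sub (x : X) (y y' : Y) : tmul γ x (y - y') = tmul γ x y - tmul γ x y' := by
  simp [tmul, TensorProduct.tmul_sub]

theorem sub_tmul (x x' : X) (y : Y) : tmul γ (x - x') y = tmul γ x y - tmul γ x' y := by
  simp [tmul, TensorProduct.sub_tmul]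

theorem tmul_smul (c : ℂ) (x : X) (y : Y) : tmul γ x (c • y) = c • tmul γ x y := by
  simp [tmul]

theorem smul_tmul' (c : ℂ) (x : X) (y : Y) : tmul γ (c • x) y = c • tmul γ x y := by
  simp [tmul, ← TensorProduct.smul_tmul']

/-- Both operators send `u ⊗ v` to `⟪y, u⟫ x ⊗ ⟪y', v⟫ x'`. -/
theorem mapL_rankOne (x y : X) (x' y' : Y) :
    mapL γ (.rankOne (A := A) x y) (.rankOne (A := B) x' y') =
      rankOne (CStarTensor γ) (tmul γ x x') (tmul γ y y') := by
  refine ext_tmul γ fun u v => ?_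
  rw [mapL_tmul, rankOne_apply, rankOne_apply, rankOne_apply, inner_tmul, smul_tmul]

theorem mapL_mem_finiteRank {f : X →L[ℂ] X} (hf : f ∈ finiteRank A X) {g : Y →L[ℂ] Y}
    (hg : g ∈ finiteRank B Y) :
    mapL γ (.of_mem_finiteRank hf) (.of_mem_finiteRank hg) ∈
      finiteRank (CStarTensor γ) (ExtTensor γ X Y) := by
  -- The goal builds its adjointability proofs from `hf` and `hg`, on which the induction runs;
  -- quantifying over them removes this dependence.
  suffices h : ∀ (f' : IsAdjointable A f) (g' : IsAdjointable B g),
      mapL γ f' g' ∈ finiteRank (CStarTensor γ) (ExtTensor γ X Y) from h _ _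
  induction hf, hg using Submodule.span_induction₂ with
  | mem_mem f g hf hg =>
    obtain ⟨x, y, rfl⟩ := hf
    obtain ⟨x', y', rfl⟩ := hg
    exact fun _ _ => Submodule.subset_span ⟨_, _, mapL_rankOne γ x y x' y'⟩
  | zero_left g hg =>
    intro f' g'
    rw [show mapL γ f' g' = 0 from ext_tmul γ fun x y => by rw [mapL_tmul]; simp [tmul]]
    exact Submodule.zero_mem _
  | zero_right f hf =>
    intro f' g'
    rw [show mapL γ f' g' = 0 from ext_tmul γ fun x y => by rw [mapL_tmul]; simp [tmul]]
    exact Submodule.zero_mem _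
  | add_left f₁ f₂ g hf₁ hf₂ hg h₁ h₂ =>
    intro f' g'
    have k₁ := IsAdjointable.of_mem_finiteRank hf₁
    have k₂ := IsAdjointable.of_mem_finiteRank hf₂
    rw [show mapL γ f' g' = mapL γ k₁ g' + mapL γ k₂ g' from
      ext_tmul γ fun x y => by simp [add_tmul]]
    exact Submodule.add_mem _ (h₁ _ _) (h₂ _ _)
  | add_right f g₁ g₂ hf hg₁ hg₂ h₁ h₂ =>
    intro f' g'
    have k₁ := IsAdjointable.of_mem_finiteRank hg₁
    have k₂ := IsAdjointable.of_mem_finiteRank hg₂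
    rw [show mapL γ f' g' = mapL γ f' k₁ + mapL γ f' k₂ from
      ext_tmul γ fun x y => by simp [tmul_add]]
    exact Submodule.add_mem _ (h₁ _ _) (h₂ _ _)
  | smul_left c f g hf hg h =>
    intro f' g'
    have k := IsAdjointable.of_mem_finiteRank hf
    rw [show mapL γ f' g' = c • mapL γ k g' from ext_tmul γ fun x y => by simp [smul_tmul']]
    exact Submodule.smul_mem _ _ (h _ _)
  | smul_right c f g hf hg h =>
    intro f' g'
    have k := IsAdjointable.of_mem_finiteRank hg
    rw [show mapL γ f' g' = c • mapL γ f' k from ext_tmul γ fun x y => by simp [tmul_smul]]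
    exact Submodule.smul_mem _ _ (h _ _)

/-- From `f ⊗ g - f' ⊗ g' = (f - f') ⊗ g + f' ⊗ (g - g')`. It gives norm continuity of `(f, g) ↦ f ⊗
g`. -/
theorem norm_mapL_sub_le {f f' : X →L[ℂ] X} (hf : IsAdjointable A f) (hf' : IsAdjointable A f')
    {g g' : Y →L[ℂ] Y} (hg : IsAdjointable B g) (hg' : IsAdjointable B g') :
    ‖mapL γ hf hg - mapL γ hf' hg'‖ ≤ ‖f - f'‖ * ‖g‖ + ‖f'‖ * ‖g - g'‖ := by
  have h : mapL γ hf hg - mapL γ hf' hg' =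
      mapL γ (hf.sub hf') hg + mapL γ hf' (hg.sub hg') :=
    ext_tmul γ fun x y => by simp [sub_tmul, tmul_sub]
  rw [h]
  exact (norm_add_le _ _).trans (add_le_add (norm_mapL_le γ _ _) (norm_mapL_le γ _ _))

/-- The tensor product of two compact operators is compact. -/
theorem mapL_mem_closure_finiteRank {f : X →L[ℂ] X} (hf : IsAdjointable A f)
    {g : Y →L[ℂ] Y} (hg : IsAdjointable B g)
    (hf' : f ∈ closure (finiteRank A X : Set (X →L[ℂ] X)))
    (hg' : g ∈ closure (finiteRank B Y : Set (Y →L[ℂ] Y))) :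
    mapL γ hf hg ∈ closure (finiteRank (CStarTensor γ) (ExtTensor γ X Y) :
      Set (ExtTensor γ X Y →L[ℂ] ExtTensor γ X Y)) := by
  obtain ⟨u, hu, hul⟩ := mem_closure_iff_seq_limit.1 hf'
  obtain ⟨v, hv, hvl⟩ := mem_closure_iff_seq_limit.1 hg'
  refine mem_closure_iff_seq_limit.2
    ⟨fun n => mapL γ (.of_mem_finiteRank (hu n)) (.of_mem_finiteRank (hv n)),
      fun n => mapL_mem_finiteRank γ (hu n) (hv n), ?_⟩
  rw [tendsto_iff_norm_sub_tendsto_zero] at hul ⊢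
  refine squeeze_zero (fun n => norm_nonneg _) (fun n => norm_mapL_sub_le γ _ _ _ _) ?_
  have h1 := hul.mul hvl.norm
  have h2 := (tendsto_iff_norm_sub_tendsto_zero.1 hvl).const_mul ‖f‖
  simpa using h1.add h2

theorem inner_mapL {f f' : X →L[ℂ] X} (hf : IsAdjointable A f) (hf' : IsAdjointable A f')
    {g g' : Y →L[ℂ] Y} (hg : IsAdjointable B g) (hg' : IsAdjointable B g')
    (h₁ : ∀ x y : X, inner A (f x) y = inner A x (f' y))
    (h₂ : ∀ x y : Y, inner B (g x) y = inner B x (g' y)) (u v : ExtTensor γ X Y) :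
    inner (CStarTensor γ) (mapL γ hf hg u) v = inner (CStarTensor γ) u (mapL γ hf' hg' v) := by
  change innerL γ (mapL γ hf hg u) v = innerL γ u (mapL γ hf' hg' v)
  refine induction_on γ (p := fun u => innerL γ (mapL γ hf hg u) v = innerL γ u (mapL γ hf' hg' v))
    u (isClosed_eq (by fun_prop) (by fun_prop)) (by simp) (fun s t hs ht => by simp [hs, ht])
    fun x y => ?_
  refine induction_on γ (p := fun v => innerL γ (mapL γ hf hg (tmul γ x y)) v =
    innerL γ (tmul γ x y) (mapL γ hf' hg' v))
    v (isClosed_eq (by fun_prop) (by fun_prop)) (by simp)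
    (fun s t hs ht => by rw [map_add, map_add, map_add, hs, ht]) fun x' y' => ?_
  have h := inner_tmul γ (f x) x' (g y) y'
  rw [h₁, h₂, ← inner_tmul] at h
  rw [mapL_tmul, mapL_tmul]
  exact h

end ExtTensor
end Map
variable (A : Type*) {X : Type*} [NonUnitalCStarAlgebra A] [PartialOrder A] [StarOrderedRing A]
  [NormedAddCommGroup X] [NormedSpace ℂ X] [SMul A X] [CStarModule A X] in
/-- An approximate unit of the coefficient algebra acts as an approximate unit on the module. -/
theorem tendsto_approximateUnit_smul (x : X) :
    Tendsto (fun e : A => e • x) (CStarAlgebra.approximateUnit A) (𝓝 x) := by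
  have hu := CStarAlgebra.increasingApproximateUnit A
  have h1 := tendsto_iff_norm_sub_tendsto_zero.1 (hu.tendsto_mul_right (inner A x x))
  rw [tendsto_iff_norm_sub_tendsto_zero]
  -- With `d = e ⟪x, x⟫ - ⟪x, x⟫` one has `⟪e x - x, e x - x⟫ = d e⋆ - d`, of norm at most `2 ‖d‖`
  -- once `‖e‖ ≤ 1`.
  have h2 : Tendsto (fun e : A => √(‖e * inner A x x - inner A x x‖ * 2))
      (CStarAlgebra.approximateUnit A) (𝓝 0) := by
    simpa using (h1.mul_const 2).sqrt
  refine squeeze_zero' (.of_forall fun e => norm_nonneg _) ?_ h2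
  filter_upwards [hu.eventually_norm] with e he
  refine Real.le_sqrt_of_sq_le ?_
  have h3 : inner A (e • x - x) (e • x - x) =
      (e * inner A x x - inner A x x) * star e - (e * inner A x x - inner A x x) := by
    simp only [CStarModule.inner_sub_left, CStarModule.inner_sub_right,
      CStarModule.inner_op_smul_left, CStarModule.inner_op_smul_right, sub_mul, mul_sub, mul_assoc]
    abel
  rw [CStarModule.norm_sq_eq A, h3, mul_two]
  refine (norm_sub_le _ _).trans (add_le_add_left ((norm_mul_le _ _).trans ?_) _)
  exact mul_le_of_le_one_right (norm_nonneg _) (by rwa [norm_star])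

/-! ### Separate continuity of elementary tensors, countable generation and witnesses -/

section Continuity
variable {A B X Y : Type*}
  [NonUnitalCStarAlgebra A] [PartialOrder A] [StarOrderedRing A]
  [NormedAddCommGroup X] [NormedSpace ℂ X] [SMul A X] [CStarModule A X]
  [NonUnitalCStarAlgebra B] [PartialOrder B] [StarOrderedRing B]
  [NormedAddCommGroup Y] [NormedSpace ℂ Y] [SMul B Y] [CStarModule B Y]
  (γ : TensorCStarSeminorm A B)

open CStarTensor

theorem ofAlg_tmul_nonneg {a : A} {b : B} (ha : 0 ≤ a) (hb : 0 ≤ b) :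
    0 ≤ ofAlg γ (a ⊗ₜ[ℂ] b) := by
  obtain ⟨c, rfl⟩ := CStarAlgebra.nonneg_iff_eq_mul_star_self.1 ha
  obtain ⟨d, rfl⟩ := CStarAlgebra.nonneg_iff_eq_mul_star_self.1 hb
  rw [← Algebra.TensorProduct.tmul_mul_tmul, ← TensorProduct.star_tmul, ofAlg_mul, ofAlg_star]
  exact mul_star_self_nonneg _

/-- For fixed `b ≥ 0` the map `a ↦ a ⊗ b` is positive, and positive linear maps between C⋆-algebras
are automatically bounded. The constant may depend on `b`, as only separate continuity is needed. -/
theorem exists_norm_ofAlg_tmul_le_left {b : B} (hb : 0 ≤ b) :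
    ∃ C : ℝ, 0 ≤ C ∧ ∀ a : A, ‖ofAlg γ (a ⊗ₜ[ℂ] b)‖ ≤ C * ‖a‖ := by
  obtain ⟨C, hC⟩ := (PositiveLinearMap.mk₀ (ofAlg γ ∘ₗ (TensorProduct.mk ℂ A B).flip b)
    fun a ha => ofAlg_tmul_nonneg γ ha hb).exists_norm_apply_le
  exact ⟨C, C.2, hC⟩

theorem exists_norm_ofAlg_tmul_le_right {a : A} (ha : 0 ≤ a) :
    ∃ C : ℝ, 0 ≤ C ∧ ∀ b : B, ‖ofAlg γ (a ⊗ₜ[ℂ] b)‖ ≤ C * ‖b‖ := by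
  obtain ⟨C, hC⟩ := (PositiveLinearMap.mk₀ (ofAlg γ ∘ₗ TensorProduct.mk ℂ A B a)
    fun b hb => ofAlg_tmul_nonneg γ ha hb).exists_norm_apply_le
  exact ⟨C, C.2, hC⟩

namespace ExtTensor

theorem norm_tmul (x : X) (y : Y) :
    ‖tmul γ x y‖ = √‖ofAlg γ (inner A x x ⊗ₜ[ℂ] inner B y y)‖ := by
  rw [tmul, norm_ofMod, algInner_tmul]

/-- `‖x ⊗ y‖² = ‖⟪x, x⟫ ⊗ ⟪y, y⟫‖ ≤ C ‖x‖²`, with `C` the bound belonging to `⟪y, y⟫ ≥ 0`. -/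
theorem continuous_tmul_left (y : Y) : Continuous fun x : X => tmul γ x y := by
  obtain ⟨C, hC0, hC⟩ := exists_norm_ofAlg_tmul_le_left (A := A) γ
    (CStarModule.inner_self_nonneg (A := B) (x := y))
  refine (LinearMap.mkContinuous (ofMod γ X Y ∘ₗ (TensorProduct.mk ℂ X Y).flip y) (√C)
    fun x => ?_).continuous
  refine (norm_tmul γ x y).trans_le (Real.sqrt_le_iff.2 ⟨by positivity, (hC _).trans_eq ?_⟩)
  rw [mul_pow, Real.sq_sqrt hC0, CStarModule.norm_sq_eq A]

theorem continuous_tmul_right (x : X) : Continuous fun y : Y => tmul γ x y := by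
  obtain ⟨C, hC0, hC⟩ := exists_norm_ofAlg_tmul_le_right (B := B) γ
    (CStarModule.inner_self_nonneg (A := A) (x := x))
  refine (LinearMap.mkContinuous (ofMod γ X Y ∘ₗ TensorProduct.mk ℂ X Y x) (√C)
    fun y => ?_).continuous
  refine (norm_tmul γ x y).trans_le (Real.sqrt_le_iff.2 ⟨by positivity, (hC _).trans_eq ?_⟩)
  rw [mul_pow, Real.sq_sqrt hC0, CStarModule.norm_sq_eq B]

end ExtTensor

open ExtTensor

namespace HilbertSubmodule

variable {γ}

/-- `a x ⊗ y` is the limit of `(a ⊗ e)(x ⊗ y) = a x ⊗ e y` along an approximate unit of `B`, and `Z`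
is closed. -/
theorem smul_tmul_left_mem (Z : HilbertSubmodule (CStarTensor γ) (ExtTensor γ X Y)) (a : A)
    {x : X} {y : Y} (h : tmul γ x y ∈ Z.carrier) : tmul γ (a • x) y ∈ Z.carrier := by
  refine Z.isClosed'.mem_of_tendsto (((continuous_tmul_right γ (a • x)).tendsto y).comp
    (tendsto_approximateUnit_smul B y)) (.of_forall fun e => ?_)
  change tmul γ (a • x) (e • y) ∈ Z.carrier
  rw [← smul_tmul]
  exact Z.act_mem' _ _ h

theorem smul_tmul_right_mem (Z : HilbertSubmodule (CStarTensor γ) (ExtTensor γ X Y)) (b : B)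
    {x : X} {y : Y} (h : tmul γ x y ∈ Z.carrier) : tmul γ x (b • y) ∈ Z.carrier := by
  refine Z.isClosed'.mem_of_tendsto (((continuous_tmul_left γ (b • y)).tendsto x).comp
    (tendsto_approximateUnit_smul A x)) (.of_forall fun e => ?_)
  change tmul γ (e • x) (b • y) ∈ Z.carrier
  rw [← smul_tmul]
  exact Z.act_mem' _ _ h

/-- The vectors `x` with `x ⊗ y ∈ Z` for all `y ∈ T`. -/
def leftSection (Z : HilbertSubmodule (CStarTensor γ) (ExtTensor γ X Y)) (T : Set Y) :
    HilbertSubmodule A X where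
  carrier := {x | ∀ y ∈ T, tmul γ x y ∈ Z.carrier}
  add_mem' hs ht y hy := by rw [add_tmul]; exact Z.add_mem (hs y hy) (ht y hy)
  zero_mem' y _ := by simp [tmul]
  smul_mem' c x hx y hy := by rw [smul_tmul']; exact Z.smul_mem c (hx y hy)
  act_mem' a x hx y hy := Z.smul_tmul_left_mem a (hx y hy)
  isClosed' := by
    simp only [Set.ofPred_forall]
    exact isClosed_biInter fun y _ => Z.isClosed'.preimage (continuous_tmul_left γ y)

/-- The vectors `y` with `x ⊗ y ∈ Z` for all `x ∈ S`. -/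
def rightSection (Z : HilbertSubmodule (CStarTensor γ) (ExtTensor γ X Y)) (S : Set X) :
    HilbertSubmodule B Y where
  carrier := {y | ∀ x ∈ S, tmul γ x y ∈ Z.carrier}
  add_mem' hs ht x hx := by rw [tmul_add]; exact Z.add_mem (hs x hx) (ht x hx)
  zero_mem' x _ := by simp [tmul]
  smul_mem' c y hy x hx := by rw [tmul_smul]; exact Z.smul_mem c (hy x hx)
  act_mem' b y hy x hx := Z.smul_tmul_right_mem b (hy x hx)
  isClosed' := by
    simp only [Set.ofPred_forall]
    exact isClosed_biInter fun x _ => Z.isClosed'.preimage (continuous_tmul_right γ x)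

variable (γ)

theorem tmul_mem_tensor {Y₁ : HilbertSubmodule A X} {Y₂ : HilbertSubmodule B Y} {x : X} {y : Y}
    (hx : x ∈ Y₁.carrier) (hy : y ∈ Y₂.carrier) : tmul γ x y ∈ (Y₁.tensor γ Y₂).carrier :=
  subset_closure ⟨x ⊗ₜ y, ⟨(⟨x, hx⟩ : Y₁.toSubmodule) ⊗ₜ[ℂ] (⟨y, hy⟩ : Y₂.toSubmodule), by simp⟩,
    rfl⟩

/-- Induction principle for vectors in `Y₁ ⊗ Y₂`. -/
theorem tensor_induction {Y₁ : HilbertSubmodule A X} {Y₂ : HilbertSubmodule B Y}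
    {p : ExtTensor γ X Y → Prop} (hc : IsClosed {z | p z}) (h0 : p 0)
    (hadd : ∀ s t, p s → p t → p (s + t))
    (ht : ∀ x ∈ Y₁.carrier, ∀ y ∈ Y₂.carrier, p (tmul γ x y))
    {z : ExtTensor γ X Y} (hz : z ∈ (Y₁.tensor γ Y₂).carrier) : p z := by
  refine closure_minimal (t := {z | p z}) ?_ hc hz
  rintro _ ⟨_, ⟨t, rfl⟩, rfl⟩
  change p _
  induction t using TensorProduct.induction_on with
  | zero => simpa using h0
  | add s t hs ht => rw [map_add, map_add]; exact hadd _ _ hs ht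
  | tmul x y => exact ht x x.2 y y.2

/-- One leg at a time: the left section of `Z` over `T` contains `S`, hence `Y₁`; so the right
section over all of `Y₁` contains `T`, hence `Y₂`. -/
theorem tmul_mem_of_generators {Y₁ : HilbertSubmodule A X} {Y₂ : HilbertSubmodule B Y}
    {S : Set X} {T : Set Y}
    (hS : ∀ Z : HilbertSubmodule A X, S ⊆ Z.carrier → Y₁.carrier ⊆ Z.carrier)
    (hT : ∀ Z : HilbertSubmodule B Y, T ⊆ Z.carrier → Y₂.carrier ⊆ Z.carrier)
    {Z : HilbertSubmodule (CStarTensor γ) (ExtTensor γ X Y)}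
    (hZ : Set.image2 (tmul γ) S T ⊆ Z.carrier) {x : X} {y : Y}
    (hx : x ∈ Y₁.carrier) (hy : y ∈ Y₂.carrier) : tmul γ x y ∈ Z.carrier := by
  have h1 : Y₁.carrier ⊆ (Z.leftSection T).carrier :=
    hS _ fun x hx y hy => hZ ⟨x, hx, y, hy, rfl⟩
  have h2 : Y₂.carrier ⊆ (Z.rightSection Y₁.carrier).carrier :=
    hT _ fun y hy x hx => h1 hx y hy
  exact h2 hy x hx

theorem CountablyGenerated.tensor {Y₁ : HilbertSubmodule A X} {Y₂ : HilbertSubmodule B Y}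
    (h₁ : Y₁.CountablyGenerated) (h₂ : Y₂.CountablyGenerated) :
    (Y₁.tensor γ Y₂).CountablyGenerated := by
  obtain ⟨S, hSc, hSY, hS⟩ := h₁
  obtain ⟨T, hTc, hTY, hT⟩ := h₂
  refine ⟨Set.image2 (tmul γ) S T, hSc.image2 hTc _, ?_, fun Z hZ z hz => ?_⟩
  · rintro _ ⟨x, hx, y, hy, rfl⟩
    exact tmul_mem_tensor γ (hSY hx) (hTY hy)
  · exact tensor_induction γ (p := (· ∈ Z.carrier)) Z.isClosed' Z.zero_mem
      (fun _ _ => Z.add_mem) (fun x hx y hy => tmul_mem_of_generators γ hS hT hZ hx hy) hz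

/-- A countable generating set of `whole ⊗ whole` suffices, since that submodule contains all
elementary tensors and these span a dense subspace. -/
theorem CountablyGenerated.whole_tensor (h₁ : (whole A X).CountablyGenerated)
    (h₂ : (whole B Y).CountablyGenerated) :
    (whole (CStarTensor γ) (ExtTensor γ X Y)).CountablyGenerated := by
  obtain ⟨S, hSc, -, hS⟩ := h₁.tensor γ h₂
  refine ⟨S, hSc, Set.subset_univ S, fun Z hZ z _ => ?_⟩
  exact ExtTensor.induction_on γ (p := (· ∈ Z.carrier)) z Z.isClosed' Z.zero_mem
    (fun _ _ => Z.add_mem) fun x y => hS Z hZ (tmul_mem_tensor γ trivial trivial)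

theorem Witness.tensor {Y₁ : HilbertSubmodule A X} {Y₂ : HilbertSubmodule B Y}
    {b₁ : X →L[ℂ] X} {b₂ : Y →L[ℂ] Y} (h₁ : Y₁.Witness b₁) (h₂ : Y₂.Witness b₂) :
    (Y₁.tensor γ Y₂).Witness
      (mapL γ (.of_selfAdjoint h₁.1.2) (.of_selfAdjoint h₂.1.2)) := by
  refine ⟨⟨mapL_mem_closure_finiteRank γ _ _ h₁.1.1 h₂.1.1,
    inner_mapL γ _ _ _ _ h₁.1.2 h₂.1.2⟩, fun z hz => ?_⟩
  refine tensor_induction γ (p := fun z => mapL γ (.of_selfAdjoint h₁.1.2)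
    (.of_selfAdjoint h₂.1.2) z = z) (isClosed_eq (by fun_prop) continuous_id) (map_zero _)
    (fun s t hs ht => by rw [map_add, hs, ht]) (fun x hx y hy => ?_) hz
  rw [mapL_tmul, h₁.2 x hx, h₂.2 y hy]

end HilbertSubmodule
end Continuity
end HilbertTensor

/-- Let `γ` be the spatial norm on `A ⊙ B`, or any C⋆-norm above it. If `Y₁ ⊂⊂ X₁` and `Y₂ ⊂⊂ X₂`,
then `Y₁ ⊗ Y₂ ⊂⊂ X₁ ⊗ X₂` over `A ⊗_γ B`; whenever `b₁` and `b₂` are witnesses for the hypotheses,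
the operator `b₁ ⊗ b₂` exists and is a witness for the conclusion. -/
theorem theorem4p1 {A B X₁ X₂ : Type*}
    [NonUnitalCStarAlgebra A] [PartialOrder A] [StarOrderedRing A]
    [NonUnitalCStarAlgebra B] [PartialOrder B] [StarOrderedRing B]
    [NormedAddCommGroup X₁] [NormedSpace ℂ X₁] [SMul A X₁] [CStarModule A X₁] [CompleteSpace X₁]
    [NormedAddCommGroup X₂] [NormedSpace ℂ X₂] [SMul B X₂] [CStarModule B X₂] [CompleteSpace X₂]
    (γ : HilbertTensor.TensorCStarSeminorm A B)
    (hγ : (HilbertTensor.spatial A B).toSeminorm ≤ γ.toSeminorm)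
    (Y₁ : HilbertTensor.HilbertSubmodule A X₁) (Y₂ : HilbertTensor.HilbertSubmodule B X₂)
    (h₁ : Y₁.CompactlyContained) (h₂ : Y₂.CompactlyContained) :
    (Y₁.tensor γ Y₂).CompactlyContained ∧
    ∀ (b₁ : X₁ →L[ℂ] X₁) (b₂ : X₂ →L[ℂ] X₂), Y₁.Witness b₁ → Y₂.Witness b₂ →
      ∃ b : HilbertTensor.ExtTensor γ X₁ X₂ →L[ℂ] HilbertTensor.ExtTensor γ X₁ X₂,
        (∀ (x₁ : X₁) (x₂ : X₂), b (HilbertTensor.ExtTensor.tmul γ x₁ x₂) =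
          HilbertTensor.ExtTensor.tmul γ (b₁ x₁) (b₂ x₂)) ∧
        (Y₁.tensor γ Y₂).Witness b := by
  obtain ⟨hY₁, hX₁, b₁, hb₁⟩ := h₁
  obtain ⟨hY₂, hX₂, b₂, hb₂⟩ := h₂
  exact ⟨⟨hY₁.tensor γ hY₂, hX₁.whole_tensor γ hX₂, _, hb₁.tensor γ hb₂⟩, fun b₁ b₂ h₁ h₂ =>
    ⟨_, HilbertTensor.ExtTensor.mapL_tmul γ _ _, h₁.tensor γ h₂⟩⟩
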